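/- Let $V$ be a real Hilbert space and let $a,b:V\times V\to\mathbb R$ be bounded symmetric bilinear forms such that $a$ is coercive, $b(v,v)>0$ for $v\neq 0$, and $f\mapsto b(f,\cdot)$ is a compact map from $V$ to its dual. Put $\|v\|_a=a(v,v)^{1/2}$, and let $T:V\to V$ be the solution operator, $a(Tf,v)=b(f,v)$ for all $v\in V$. Let $(\lambda,u)$ be an eigenpair, $a(u,v)=\lambda b(u,v)$ for all $v\in V$ and $b(u,u)=1$, where $\lambda$ is a simple eigenvalue and is the $i$-th one (eigenvalues are listed in nondecreasing order with multiplicity). (An example is the Stokes eigenvalue problem, with $V$ the divergence-free fields in $H^1_0(\Omega)^2$, $a(u,v)=\int_\Omega\nabla u\cdot\nabla v$ and $b(u,v)=\int_\Omega u\cdot v$.) For a finite-dimensional subspace $U\subset V$ let $$\delta_U(\lambda)=\sup_{w\in M(\lambda)}\inf_{v\in U}\|w-v\|_a,\qquad \eta_a(U)=\sup_{f\in V,\ \|f\|_a=1}\ \inf_{v\in U}\|Tf-v\|_a,$$ where $M(\lambda)$ is the set of eigenfunctions $w$ for $\lambda$ with $b(w,w)=1$. Let $n\ge 2$ and let $V_H=V_{h_1}\subset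 V_{h_2}\subset\dots\subset V_{h_n}\subset V$ be finite-dimensional; write $\delta_{h_k}(\lambda)=\delta_{V_{h_k}}(\lambda)$ and $\eta_a(H)=\eta_a(V_H)$. The multi-level correction scheme is the following. 1. $(\lambda_{h_1},u_{h_1})$ is an $i$-th eigenpair of the problem restricted to $V_H$, with $b(u_{h_1},u_{h_1})=1$. 2. For $k=1,\dots,n-2$: let $\tilde u_{h_{k+1}}\in V_{h_{k+1}}$ solve $a(\tilde u_{h_{k+1}},v)=\lambda_{h_k}b(u_{h_k},v)$ for all $v\in V_{h_{k+1}}$, and let $(\lambda_{h_{k+1}},u_{h_{k+1}})$ be an $i$-th eigenpair of the problem restricted to $V_H+\mathrm{span}\{\tilde u_{h_{k+1}}\}$, with $b(u_{h_{k+1}},u_{h_{k+1}})=1$. 3. Let $u_{h_n}\in V_{h_n}$ solve $a(u_{h_n},v)=\lambda_{h_{n-1}}b(u_{h_{n-1}},v)$ for all $v\in V_{h_n}$, and put $\lambda_{h_n}=a(u_{h_n},u_{h_n})/b(u_{h_n},u_{h_n})$. Theorem. There is $\eta_0>0$, depending only on $V,a,b,i,\lambda,u$, such that for every $n\ge 2$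 there is a constant $C>0$, depending only on these data and $n$ (not on the spaces $V_{h_k}$), with the following property. If the coarse space is fine enough that $\eta_a(H)\le\eta_0$, then every outcome of the scheme satisfies, for a suitable choice of the sign of $u$ (the eigenfunction being determined only up to sign), $$\|u_{h_n}-u\|_a\le C\,\varepsilon_{h_n}(\lambda),\qquad |\lambda_{h_n}-\lambda|\le C\,\varepsilon_{h_n}(\lambda)^2,\qquad \varepsilon_{h_n}(\lambda)=\sum_{k=1}^n\eta_a(H)^{n-k}\delta_{h_k}(\lambda).$$ -/

import Mathlib

/-- The variational eigenvalue problem `a(u,v) = λ b(u,v)` on a real Hilbert space `V`: `a` is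
bounded, symmetric and coercive, `b` is bounded, symmetric and positive definite, and `f ↦ b(f,·)`,
as a map from `V` to its dual, is compact (equivalently, the solution operator is compact). -/
structure EigenProblem (V : Type*) [NormedAddCommGroup V] [InnerProductSpace ℝ V] where
  a : V →L[ℝ] V →L[ℝ] ℝ
  b : V →L[ℝ] V →L[ℝ] ℝ
  a_symm : ∀ v w : V, a v w = a w v
  a_coercive : IsCoercive a
  b_symm : ∀ v w : V, b v w = b w v
  b_pos : ∀ v : V, v ≠ 0 → 0 < b v v
  b_compact : IsCompactOperator b

namespace EigenProblem

variable {V : Type*} [NormedAddCommGroup V] [InnerProductSpace ℝ V]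

/-- The energy norm `‖v‖_a = a(v,v)^{1/2}`. -/
noncomputable def aNorm (P : EigenProblem V) (v : V) : ℝ := Real.sqrt (P.a v v)

/-- `w ∈ U` is the Galerkin solution in `U` of `a(w,v) = b(f,v)` for all `v ∈ U`. -/
def IsSourceSolution (P : EigenProblem V) (U : Submodule ℝ V) (f w : V) : Prop :=
  w ∈ U ∧ ∀ v ∈ U, P.a w v = P.b f v

/-- `(μ, w)` is an eigenpair of the problem restricted to `U` (with `U = ⊤`, of the problem itself),
not normalized. -/
def IsEigenpair (P : EigenProblem V) (U : Submodule ℝ V) (μ : ℝ) (w : V) : Prop :=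
  w ∈ U ∧ w ≠ 0 ∧ ∀ v ∈ U, P.a w v = μ * P.b w v

/-- `μ` is the `i`-th eigenvalue (`i = 1, 2, …`) on `U`, when the eigenvalues are listed in
nondecreasing order and repeated according to multiplicity: fewer than `i` of them are `< μ`, and
at least `i` of them are `≤ μ`. -/
def IsNthEigenvalue (P : EigenProblem V) (U : Submodule ℝ V) (i : ℕ) (μ : ℝ) : Prop :=
  Module.finrank ℝ (Submodule.span ℝ {w : V | ∃ ν < μ, P.IsEigenpair U ν w}) < i ∧
    i ≤ Module.finrank ℝ (Submodule.span ℝ {w : V | ∃ ν ≤ μ, P.IsEigenpair U ν w})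

/-- `(μ, w)` is an `i`-th eigenpair on `U`, normalized by `b(w,w) = 1`. -/
def IsNthEigenpair (P : EigenProblem V) (U : Submodule ℝ V) (i : ℕ) (μ : ℝ) (w : V) : Prop :=
  P.IsNthEigenvalue U i μ ∧ P.IsEigenpair U μ w ∧ P.b w w = 1

/-- `λ` is a simple eigenvalue: its eigenspace is one-dimensional. -/
def IsSimple (P : EigenProblem V) (lam : ℝ) : Prop :=
  ∃ u : V, P.IsEigenpair ⊤ lam u ∧ ∀ w : V, P.IsEigenpair ⊤ lam w → ∃ c : ℝ, w = c • u

/-- `M(λ)`: the exact eigenfunctions `w` for `λ` with `b(w,w) = 1`. -/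
def eigenSet (P : EigenProblem V) (lam : ℝ) : Set V :=
  {w : V | P.IsEigenpair ⊤ lam w ∧ P.b w w = 1}

/-- `inf_{v ∈ U} ‖w - v‖_a`. -/
noncomputable def aDist (P : EigenProblem V) (U : Submodule ℝ V) (w : V) : ℝ :=
  ⨅ v : U, P.aNorm (w - v)

/-- `δ_U(λ) = sup_{w ∈ M(λ)} inf_{v ∈ U} ‖w - v‖_a`. -/
noncomputable def delta (P : EigenProblem V) (lam : ℝ) (U : Submodule ℝ V) : ℝ :=
  sSup ((fun w => P.aDist U w) '' P.eigenSet lam)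

/-- The solution operator `T`, with `a(Tf,v) = b(f,v)` for all `v ∈ V`. -/
noncomputable def T [CompleteSpace V] (P : EigenProblem V) (f : V) : V :=
  P.a_coercive.continuousLinearEquivOfBilin.symm ((InnerProductSpace.toDual ℝ V).symm (P.b f))

theorem a_T [CompleteSpace V] (P : EigenProblem V) (f v : V) : P.a (P.T f) v = P.b f v := by
  rw [← P.a_coercive.continuousLinearEquivOfBilin_apply (P.T f) v]
  simp [T]

/-- `η_a(U) = sup_{f ∈ V, ‖f‖_a = 1} inf_{v ∈ U} ‖Tf - v‖_a`. -/
noncomputable def eta [CompleteSpace V] (P : EigenProblem V) (U : Submodule ℝ V) : ℝ :=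
  sSup ((fun f => P.aDist U (P.T f)) '' {f : V | P.aNorm f = 1})

/-- One correction step `(μ', w') = Correction(V_H, μ, w, V_h)`: solve the source problem with
right-hand side `μ b(w,·)` in `V_h` for `wt`, then take the `i`-th eigenpair on
`V_H + span {wt}`. -/
def IsCorrection (P : EigenProblem V) (i : ℕ) (VH : Submodule ℝ V) (μ : ℝ) (w : V)
    (Vh : Submodule ℝ V) (μ' : ℝ) (w' : V) : Prop :=
  ∃ wt : V, P.IsSourceSolution Vh (μ • w) wt ∧
    P.IsNthEigenpair (VH ⊔ Submodule.span ℝ {wt}) i μ' w'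

/-- `(lamh k, uh k)`, `k = 1, …, n`, are the iterates of the multi-level correction scheme for the
`i`-th eigenpair on the spaces `Vh 1 = V_H, Vh 2, …, Vh n`. -/
structure IsMultilevelCorrection (P : EigenProblem V) (i n : ℕ) (Vh : ℕ → Submodule ℝ V)
    (lamh : ℕ → ℝ) (uh : ℕ → V) : Prop where
  init : P.IsNthEigenpair (Vh 1) i (lamh 1) (uh 1)
  step : ∀ k, 1 ≤ k → k + 1 < n →
    P.IsCorrection i (Vh 1) (lamh k) (uh k) (Vh (k + 1)) (lamh (k + 1)) (uh (k + 1))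
  final : P.IsSourceSolution (Vh n) (lamh (n - 1) • uh (n - 1)) (uh n)
  rayleigh : lamh n = P.a (uh n) (uh n) / P.b (uh n) (uh n)

/-- `ε_{h_n}(λ) = ∑_{k=1}^n η_a(H)^{n-k} δ_{h_k}(λ)`, where `V_H = Vh 1`. -/
noncomputable def epsilon [CompleteSpace V] (P : EigenProblem V) (lam : ℝ)
    (Vh : ℕ → Submodule ℝ V) (n : ℕ) : ℝ :=
  ∑ k ∈ Finset.Icc 1 n, P.eta (Vh 1) ^ (n - k) * P.delta lam (Vh k)

end EigenProblem

namespace EigenProblem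

variable {V : Type*} [NormedAddCommGroup V] [InnerProductSpace ℝ V]

/-! ### The energy norm -/

/-! The scheme passes from one level to the next only through the source data `ν • w` of a discrete
eigenpair on a space `W ⊇ V_H`. A Galerkin solve in `V_h` with these data has error at most `dist(u,
V_h) + ‖T(νw - σλu)‖_a`, with `σ = ±1`. So everything rests on the superconvergence estimate `‖T(νw
- σλu)‖_a ≤ C η_a(H) dist(u, W)` (`exists_discrete_estimate`). The solved function lies in the next
correction space, hence `dist(u, W_{k+1}) ≤ δ_{k+1} + C η dist(u, W_k)`. This is the recursion of
`epsilon_succ` up to the factor `C`, and induction gives `(1 + C)^k ε_k`. The eigenvalue bound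
follows because the Rayleigh quotient is stationary at `u`.

For the superconvergence, duality (Aubin–Nitsche) makes `T(u - Πu)` smaller than `u - Πu` by a
factor `η`, where `Π` is the energy projection onto `W`. Simplicity and compactness make `T - λ⁻¹`
bounded below on the complement of `u` (`exists_gap`), and this survives discretization on the
complement of `w` (`gap_discrete`). Applied to the part of `Πu` orthogonal to `w`, it shows that
this part is of order `η dist(u, W)`. The errors in the eigenvalue and in the normalization are then
of the same order.

That the `i`-th discrete eigenvalue is near `λ` at all comes from a two-sided min-max comparison
(`le_of_top`, `inv_sub_le`). It rests on the fact that `b/a` attains its maximum on the orthogonal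
complement of the lower eigenvectors, so no spectral decomposition is needed. -/

theorem a_nonneg (P : EigenProblem V) (v : V) : 0 ≤ P.a v v := by
  obtain ⟨c, hc, h⟩ := P.a_coercive
  exact le_trans (by positivity) (h v)

theorem b_nonneg (P : EigenProblem V) (v : V) : 0 ≤ P.b v v := by
  by_cases h : v = 0
  · simp [h]
  · exact (P.b_pos v h).le

theorem eq_zero_of_a_self (P : EigenProblem V) {v : V} (h : P.a v v = 0) : v = 0 := by
  obtain ⟨c, hc, hcv⟩ := P.a_coercive
  have h1 := hcv v
  rw [h, mul_assoc] at h1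
  have h2 : ‖v‖ * ‖v‖ ≤ 0 := by
    by_contra! h3
    nlinarith [mul_pos hc h3]
  exact norm_eq_zero.1 (by nlinarith [norm_nonneg v])

theorem a_sq_le (P : EigenProblem V) (v w : V) : P.a v w ^ 2 ≤ P.a v v * P.a w w := by
  have h := discrim_le_zero (a := P.a w w) (b := 2 * P.a v w) (c := P.a v v) (fun t => by
    have := P.a_nonneg (v + t • w)
    simp only [map_add, map_smul, add_apply, smul_apply,
      smul_eq_mul, P.a_symm w v] at this
    linarith)
  rw [discrim] at h
  linarith

theorem b_sq_le (P : EigenProblem V) (v w : V) : P.b v w ^ 2 ≤ P.b v v * P.b w w := by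
  have h := discrim_le_zero (a := P.b w w) (b := 2 * P.b v w) (c := P.b v v) (fun t => by
    have := P.b_nonneg (v + t • w)
    simp only [map_add, map_smul, add_apply, smul_apply,
      smul_eq_mul, P.b_symm w v] at this
    linarith)
  rw [discrim] at h
  linarith

theorem aNorm_nonneg (P : EigenProblem V) (v : V) : 0 ≤ P.aNorm v := Real.sqrt_nonneg _

theorem aNorm_sq (P : EigenProblem V) (v : V) : P.aNorm v ^ 2 = P.a v v :=
  Real.sq_sqrt (P.a_nonneg v)

theorem abs_a_le (P : EigenProblem V) (v w : V) : |P.a v w| ≤ P.aNorm v * P.aNorm w := by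
  apply abs_le_of_sq_le_sq _ (mul_nonneg (P.aNorm_nonneg v) (P.aNorm_nonneg w))
  rw [mul_pow, aNorm_sq, aNorm_sq]
  exact P.a_sq_le v w

theorem a_le (P : EigenProblem V) (v w : V) : P.a v w ≤ P.aNorm v * P.aNorm w :=
  (le_abs_self _).trans (P.abs_a_le v w)

theorem aNorm_smul (P : EigenProblem V) (t : ℝ) (v : V) : P.aNorm (t • v) = |t| * P.aNorm v := by
  rw [aNorm, aNorm, ← Real.sqrt_sq_eq_abs, ← Real.sqrt_mul (sq_nonneg t)]
  simp [pow_two, mul_assoc]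

theorem aNorm_zero (P : EigenProblem V) : P.aNorm 0 = 0 := by simp [aNorm]

theorem aNorm_neg (P : EigenProblem V) (v : V) : P.aNorm (-v) = P.aNorm v := by simp [aNorm]

theorem aNorm_sub_comm (P : EigenProblem V) (v w : V) : P.aNorm (v - w) = P.aNorm (w - v) := by
  rw [← neg_sub, aNorm_neg]

theorem aNorm_add_le (P : EigenProblem V) (v w : V) :
    P.aNorm (v + w) ≤ P.aNorm v + P.aNorm w := by
  apply le_of_sq_le_sq _ (add_nonneg (P.aNorm_nonneg v) (P.aNorm_nonneg w))
  rw [add_sq, aNorm_sq, aNorm_sq, aNorm_sq]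
  have := P.a_le v w
  simp only [map_add, add_apply, P.a_symm w v]
  linarith

theorem aNorm_sub_le (P : EigenProblem V) (v w : V) :
    P.aNorm (v - w) ≤ P.aNorm v + P.aNorm w := by
  have := P.aNorm_add_le v (-w)
  rwa [← sub_eq_add_neg, aNorm_neg] at this

theorem eq_zero_of_aNorm (P : EigenProblem V) {v : V} (h : P.aNorm v = 0) : v = 0 :=
  P.eq_zero_of_a_self (by rw [← aNorm_sq, h]; simp)

/-- A bound in energy norm from testing with the vector itself. -/
theorem aNorm_le_of_sq_le (P : EigenProblem V) {v : V} {C : ℝ} (hC : 0 ≤ C)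
    (h : P.a v v ≤ C * P.aNorm v) : P.aNorm v ≤ C := by
  rw [← aNorm_sq] at h
  rcases (P.aNorm_nonneg v).eq_or_lt with h0 | h0
  · rwa [← h0]
  · nlinarith

theorem aNorm_le_aNorm_add (P : EigenProblem V) {v w : V} (h : P.a v w = 0) :
    P.aNorm v ≤ P.aNorm (v + w) := by
  apply le_of_sq_le_sq _ (P.aNorm_nonneg _)
  rw [aNorm_sq, aNorm_sq]
  simp only [map_add, add_apply, P.a_symm w v, h]
  linarith [P.a_nonneg w]

theorem continuous_aNorm (P : EigenProblem V) : Continuous P.aNorm := by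
  unfold aNorm
  fun_prop

theorem exists_norm_le_aNorm (P : EigenProblem V) : ∃ K > 0, ∀ v, ‖v‖ ≤ K * P.aNorm v := by
  obtain ⟨c, hc, h⟩ := P.a_coercive
  refine ⟨(Real.sqrt c)⁻¹, by positivity, fun v => ?_⟩
  rw [inv_mul_eq_div, le_div_iff₀ (by positivity)]
  apply le_of_sq_le_sq _ (P.aNorm_nonneg v)
  rw [aNorm_sq, mul_pow, Real.sq_sqrt hc.le]
  linarith [h v]

theorem exists_b_le (P : EigenProblem V) :
    ∃ K > 0, ∀ v w, P.b v w ≤ K * (P.aNorm v * P.aNorm w) := by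
  obtain ⟨K, hK, h⟩ := P.exists_norm_le_aNorm
  refine ⟨(‖P.b‖ + 1) * K ^ 2, by positivity, fun v w => ?_⟩
  have h1 := (le_abs_self _).trans (P.b.le_opNorm₂ v w)
  have h2 : ‖P.b‖ * ‖v‖ * ‖w‖ ≤ (‖P.b‖ + 1) * (K * P.aNorm v) * (K * P.aNorm w) := by
    have := P.aNorm_nonneg v
    gcongr
    · linarith
    · exact h v
    · exact h w
  calc P.b v w ≤ _ := h1
    _ ≤ _ := h2
    _ = _ := by ring

/-! ### Galerkin solutions -/

/-- Elements of `U` are determined by their energy products with `U`. -/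
theorem eq_of_a_eq (P : EigenProblem V) {U : Submodule ℝ V} {x y : V} (hx : x ∈ U) (hy : y ∈ U)
    (h : ∀ v ∈ U, P.a x v = P.a y v) : x = y := by
  refine sub_eq_zero.1 (P.eq_zero_of_a_self ?_)
  simp only [map_sub, sub_apply]
  linarith [h x hx, h y hy]

theorem isCoercive_restrict (P : EigenProblem V) (U : Submodule ℝ V) :
    IsCoercive (P.a.bilinearComp U.subtypeL U.subtypeL) := by
  obtain ⟨c, hc, h⟩ := P.a_coercive
  exact ⟨c, hc, fun v => h v⟩

/-- The element of `U` representing the functional `g` on `U` through the energy product. -/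
noncomputable def galerkin (P : EigenProblem V) (U : Submodule ℝ V) [CompleteSpace U]
    (g : V →L[ℝ] ℝ) : V :=
  ((P.isCoercive_restrict U).continuousLinearEquivOfBilin.symm
    ((InnerProductSpace.toDual ℝ U).symm (g.comp U.subtypeL)) : U)

theorem galerkin_mem (P : EigenProblem V) (U : Submodule ℝ V) [CompleteSpace U]
    (g : V →L[ℝ] ℝ) : P.galerkin U g ∈ U := Subtype.property _

theorem a_galerkin (P : EigenProblem V) (U : Submodule ℝ V) [CompleteSpace U]
    (g : V →L[ℝ] ℝ) {v : V} (hv : v ∈ U) : P.a (P.galerkin U g) v = g v := by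
  have h := (P.isCoercive_restrict U).continuousLinearEquivOfBilin_apply
    ((P.isCoercive_restrict U).continuousLinearEquivOfBilin.symm
    ((InnerProductSpace.toDual ℝ U).symm (g.comp U.subtypeL))) ⟨v, hv⟩
  simp only [ContinuousLinearEquiv.apply_symm_apply, InnerProductSpace.toDual_symm_apply] at h
  exact h.symm

theorem continuous_galerkin (P : EigenProblem V) (U : Submodule ℝ V) [CompleteSpace U] :
    Continuous (P.galerkin U) := by
  unfold galerkin
  have h : Continuous fun g : V →L[ℝ] ℝ => g.comp U.subtypeL :=
    ((ContinuousLinearMap.compL ℝ U V ℝ).flip U.subtypeL).continuous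
  exact continuous_subtype_val.comp ((ContinuousLinearEquiv.continuous _).comp
    ((LinearIsometryEquiv.continuous _).comp h))

/-- The energy-orthogonal projection onto `U`. -/
noncomputable def proj (P : EigenProblem V) (U : Submodule ℝ V) [CompleteSpace U] (x : V) : V :=
  P.galerkin U (P.a x)

theorem proj_mem (P : EigenProblem V) (U : Submodule ℝ V) [CompleteSpace U] (x : V) :
    P.proj U x ∈ U := P.galerkin_mem U _

theorem a_proj (P : EigenProblem V) (U : Submodule ℝ V) [CompleteSpace U] (x : V) {v : V}
    (hv : v ∈ U) : P.a (P.proj U x) v = P.a x v := P.a_galerkin U _ hv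

theorem a_sub_proj (P : EigenProblem V) (U : Submodule ℝ V) [CompleteSpace U] (x : V) {v : V}
    (hv : v ∈ U) : P.a (x - P.proj U x) v = 0 := by
  rw [map_sub, sub_apply, P.a_proj U x hv, sub_self]

theorem aNorm_proj_le (P : EigenProblem V) (U : Submodule ℝ V) [CompleteSpace U] (x : V) :
    P.aNorm (P.proj U x) ≤ P.aNorm x := by
  have := P.aNorm_le_aNorm_add (v := P.proj U x) (w := x - P.proj U x)
    (by rw [P.a_symm]; exact P.a_sub_proj U x (P.proj_mem U x))
  simpa using this

theorem aNorm_sub_proj_le (P : EigenProblem V) (U : Submodule ℝ V) [CompleteSpace U] (x : V)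
    {v : V} (hv : v ∈ U) : P.aNorm (x - P.proj U x) ≤ P.aNorm (x - v) := by
  have := P.aNorm_le_aNorm_add (v := x - P.proj U x) (w := P.proj U x - v)
    (P.a_sub_proj U x (U.sub_mem (P.proj_mem U x) hv))
  simpa using this

theorem aDist_eq (P : EigenProblem V) (U : Submodule ℝ V) [CompleteSpace U] (x : V) :
    P.aDist U x = P.aNorm (x - P.proj U x) := by
  apply le_antisymm
  · exact ciInf_le (f := fun v : U => P.aNorm (x - v))
      ⟨0, by rintro _ ⟨v, rfl⟩; exact P.aNorm_nonneg _⟩ ⟨_, P.proj_mem U x⟩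
  · exact le_ciInf fun v => P.aNorm_sub_proj_le U x v.2

/-- The only entry point of compactness: `b` maps energy-bounded sets to relatively compact sets of
functionals, and the Galerkin solve is continuous in the functional. -/
theorem exists_subseq_tendsto_galerkin (P : EigenProblem V) (U : Submodule ℝ V) [CompleteSpace U]
    {v : ℕ → V} {R : ℝ} (hv : ∀ k, P.aNorm (v k) ≤ R) :
    ∃ (t : V) (φ : ℕ → ℕ), StrictMono φ ∧
      Filter.Tendsto (fun k => P.galerkin U (P.b (v (φ k)))) Filter.atTop (nhds t) := by
  obtain ⟨K, hK, h⟩ := P.exists_norm_le_aNorm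
  have hc := P.b_compact.isCompact_closure_image_closedBall (K * R)
  obtain ⟨g, -, φ, hφ, hg⟩ := hc.tendsto_subseq (x := fun k => P.b (v k)) (fun k =>
    subset_closure ⟨v k, by
      simpa using (h (v k)).trans (mul_le_mul_of_nonneg_left (hv k) hK.le), rfl⟩)
  exact ⟨_, φ, hφ, ((P.continuous_galerkin U).tendsto g).comp hg⟩

/-! ### The solution operator -/

section
variable [CompleteSpace V]

theorem T_eq_of_a (P : EigenProblem V) {f w : V} (h : ∀ v, P.a w v = P.b f v) : P.T f = w :=
  P.eq_of_a_eq (U := ⊤) trivial trivial fun v _ => by rw [a_T, h]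

theorem T_sub (P : EigenProblem V) (f g : V) : P.T (f - g) = P.T f - P.T g :=
  P.T_eq_of_a fun v => by simp [a_T]

theorem T_add (P : EigenProblem V) (f g : V) : P.T (f + g) = P.T f + P.T g :=
  P.T_eq_of_a fun v => by simp [a_T]

theorem T_smul (P : EigenProblem V) (t : ℝ) (f : V) : P.T (t • f) = t • P.T f :=
  P.T_eq_of_a fun v => by simp [a_T]

/-- Lets the exact problem be treated as the Galerkin problem on `⊤`, so that results on a complete
`U` cover both. -/
instance completeSpace_top : CompleteSpace (⊤ : Submodule ℝ V) :=
  isClosed_univ.completeSpace_coe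

theorem galerkin_b_top (P : EigenProblem V) (f : V) : P.galerkin ⊤ (P.b f) = P.T f :=
  (P.T_eq_of_a fun _ => P.a_galerkin ⊤ _ trivial).symm

theorem a_T_comm (P : EigenProblem V) (f g : V) : P.a (P.T f) g = P.a f (P.T g) := by
  rw [a_T, P.a_symm, a_T, P.b_symm]

theorem exists_aNorm_T_le (P : EigenProblem V) :
    ∃ K > 0, ∀ f, P.aNorm (P.T f) ≤ K * P.aNorm f := by
  obtain ⟨K, hK, h⟩ := P.exists_b_le
  refine ⟨K, hK, fun f => P.aNorm_le_of_sq_le (mul_nonneg hK.le (P.aNorm_nonneg f)) ?_⟩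
  rw [a_T, mul_assoc]
  exact h _ _

/-- Homogeneity in `f`. The supremum is a genuine bound because boundedness of `T` makes its set
bounded above. -/
theorem aNorm_T_sub_proj_le (P : EigenProblem V) (U : Submodule ℝ V) [CompleteSpace U] (f : V) :
    P.aNorm (P.T f - P.proj U (P.T f)) ≤ P.eta U * P.aNorm f := by
  obtain ⟨K, hK, h⟩ := P.exists_aNorm_T_le
  have hb : BddAbove ((fun f => P.aDist U (P.T f)) '' {f : V | P.aNorm f = 1}) := by
    refine ⟨K, ?_⟩
    rintro _ ⟨g, hg, rfl⟩
    have h1 := P.aNorm_sub_proj_le U (P.T g) U.zero_mem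
    have h2 := h g
    replace hg : P.aNorm g = 1 := hg
    rw [sub_zero] at h1
    rw [hg, mul_one] at h2
    simpa only [P.aDist_eq U] using h1.trans h2
  rcases (P.aNorm_nonneg f).eq_or_lt with h0 | h0
  · have hf : f = 0 := P.eq_zero_of_aNorm h0.symm
    have h1 := P.aNorm_sub_proj_le U (P.T f) U.zero_mem
    have h2 := h f
    rw [← h0, mul_zero] at h2 ⊢
    rw [sub_zero] at h1
    exact h1.trans h2
  · have h1 : P.aDist U (P.T ((P.aNorm f)⁻¹ • f)) ≤ P.eta U :=
      le_csSup hb ⟨_, by simp [aNorm_smul, abs_of_pos h0, h0.ne'], rfl⟩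
    rw [P.aDist_eq] at h1
    set g := (P.aNorm f)⁻¹ • f with hg
    have hfg : f = P.aNorm f • g := by rw [hg, smul_smul, mul_inv_cancel₀ h0.ne', one_smul]
    have h2 := P.aNorm_sub_proj_le U (P.T f) (U.smul_mem (P.aNorm f) (P.proj_mem U (P.T g)))
    have h3 : P.T f = P.aNorm f • P.T g := by rw [← T_smul, ← hfg]
    have h4 : P.aNorm (P.T f - P.aNorm f • P.proj U (P.T g))
        = P.aNorm f * P.aNorm (P.T g - P.proj U (P.T g)) := by
      rw [h3, ← smul_sub, aNorm_smul, abs_of_pos h0]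
    rw [h4] at h2
    nlinarith

end

/-! ### Eigenpairs -/

theorem IsEigenpair.pos {P : EigenProblem V} {U : Submodule ℝ V} {ν : ℝ} {w : V}
    (h : P.IsEigenpair U ν w) : 0 < ν := by
  obtain ⟨hw, h0, h⟩ := h
  have h1 := h w hw
  have h2 := P.b_pos w h0
  have h3 : 0 < P.a w w := (P.a_nonneg w).lt_of_ne fun h4 => h0 (P.eq_zero_of_a_self h4.symm)
  rw [h1] at h3
  exact pos_of_mul_pos_left h3 h2.le

theorem IsEigenpair.b_eq_zero {P : EigenProblem V} {U : Submodule ℝ V} {ν ν' : ℝ} {w w' : V}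
    (h : P.IsEigenpair U ν w) (h' : P.IsEigenpair U ν' w') (hν : ν ≠ ν') : P.b w w' = 0 := by
  have h1 := h.2.2 w' h'.1
  have h2 := h'.2.2 w h.1
  rw [P.a_symm, P.b_symm, h1] at h2
  exact (mul_eq_mul_right_iff.1 h2).resolve_left hν

/-- The elements of `U` that are energy-orthogonal to all eigenvectors on `U` with eigenvalue
below `ρ`. -/
def upperPart (P : EigenProblem V) (U : Submodule ℝ V) (ρ : ℝ) : Submodule ℝ V where
  carrier := {x | x ∈ U ∧ ∀ ν < ρ, ∀ s, P.IsEigenpair U ν s → P.a s x = 0}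
  add_mem' := fun {x y} hx hy => ⟨U.add_mem hx.1 hy.1, fun ν hν s hs => by
    rw [map_add, hx.2 ν hν s hs, hy.2 ν hν s hs, add_zero]⟩
  zero_mem' := ⟨U.zero_mem, fun ν hν s hs => map_zero _⟩
  smul_mem' := fun t x hx => ⟨U.smul_mem t hx.1, fun ν hν s hs => by
    rw [map_smul, hx.2 ν hν s hs, smul_zero]⟩

theorem isClosed_upperPart (P : EigenProblem V) (U : Submodule ℝ V) [hU : CompleteSpace U] (ρ : ℝ) :
    IsClosed (P.upperPart U ρ : Set V) := by
  have h1 : IsClosed (U : Set V) := (completeSpace_coe_iff_isComplete.1 hU).isClosed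
  have h2 : (P.upperPart U ρ : Set V)
      = (U : Set V) ∩ ⋂ (ν : ℝ) (_ : ν < ρ) (s : V) (_ : P.IsEigenpair U ν s), {x | P.a s x = 0} := by
    ext x
    simp only [Set.mem_inter_iff, Set.mem_iInter]
    rfl
  rw [h2]
  exact h1.inter (isClosed_iInter fun ν => isClosed_iInter fun _ => isClosed_iInter fun s =>
    isClosed_iInter fun _ => isClosed_eq (P.a s).continuous continuous_const)

/-- A symmetric operator preserves the orthogonal complement of its eigenvectors. -/
theorem galerkin_b_mem_upperPart (P : EigenProblem V) (U : Submodule ℝ V) [CompleteSpace U]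
    {ρ : ℝ} {x : V} (hx : x ∈ P.upperPart U ρ) : P.galerkin U (P.b x) ∈ P.upperPart U ρ := by
  refine ⟨P.galerkin_mem U _, fun ν hν s hs => ?_⟩
  have h1 := hx.2 ν hν s hs
  rw [hs.2.2 x hx.1] at h1
  rw [P.a_symm, P.a_galerkin U _ hs.1, P.b_symm]
  exact (mul_eq_zero.1 h1).resolve_left hs.pos.ne'

/-- The maximum of the Rayleigh quotient `b/a` over `upperPart U ρ` is attained at an
eigenvector. -/
theorem exists_isEigenpair_upperPart (P : EigenProblem V) (U : Submodule ℝ V) [CompleteSpace U]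
    (ρ : ℝ) {v : V} (hv : v ∈ P.upperPart U ρ) (hv0 : v ≠ 0) :
    ∃ w ∈ P.upperPart U ρ, ∃ ν, P.IsEigenpair U ν w ∧ ν * P.b v v ≤ P.a v v := by
  obtain ⟨K, hK, hb⟩ := P.exists_b_le
  set F := P.upperPart U ρ with hF
  set S : Set ℝ := (fun x => P.b x x) '' {x | x ∈ F ∧ P.aNorm x = 1} with hS
  have hbdd : BddAbove S := by
    refine ⟨K, ?_⟩
    rintro _ ⟨x, ⟨-, hx⟩, rfl⟩
    have := hb x x
    simpa [hx] using this
  have hpos : ∀ x : V, x ≠ 0 → 0 < P.aNorm x := fun x hx =>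
    (P.aNorm_nonneg x).lt_of_ne fun h => hx (P.eq_zero_of_aNorm h.symm)
  set m := sSup S with hm
  have hmem : ∀ x ∈ F, x ≠ 0 → (P.aNorm x)⁻¹ ^ 2 * P.b x x ∈ S := by
    intro x hx hx0
    refine ⟨(P.aNorm x)⁻¹ • x, ⟨F.smul_mem _ hx, ?_⟩, ?_⟩
    · rw [aNorm_smul, abs_of_pos (inv_pos.2 (hpos x hx0)), inv_mul_cancel₀ (hpos x hx0).ne']
    · simp only [map_smul, smul_apply, smul_eq_mul]
      ring
  have hle : ∀ x ∈ F, P.b x x ≤ m * P.a x x := by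
    intro x hx
    by_cases hx0 : x = 0
    · simp [hx0]
    · have h1 := le_csSup hbdd (hmem x hx hx0)
      have h2 := hpos x hx0
      rw [← hm, inv_pow, inv_mul_le_iff₀ (by positivity)] at h1
      rw [← aNorm_sq]
      linarith
  have hm0 : 0 < m := by
    have h1 := le_csSup hbdd (hmem v hv hv0)
    have h2 := hpos v hv0
    have h3 := P.b_pos v hv0
    exact lt_of_lt_of_le (by positivity) h1
  obtain ⟨y, -, hy, hyS⟩ := exists_seq_tendsto_sSup ⟨_, hmem v hv hv0⟩ hbdd
  choose x hx hxy using hyS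
  obtain ⟨t, φ, hφ, ht⟩ := P.exists_subseq_tendsto_galerkin U (v := x) (R := 1)
    (fun k => (hx k).2.le)
  have hy' := hy.comp hφ.tendsto_atTop
  set τ := fun k => P.galerkin U (P.b (x (φ k))) with hτ
  -- A maximizing sequence consists of approximate eigenvectors: expanding the square uses `a(τ,x) =
  -- b(x,x) = y` and `a(τ,τ) ≤ m²`, and the bound tends to `0` as `y → m`.
  have hsq : ∀ k, P.aNorm (τ k - m • x (φ k)) ^ 2 ≤ 2 * m ^ 2 - 2 * m * y (φ k) := by
    intro k
    have hxk := (hx (φ k)).1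
    have hτF : τ k ∈ F := P.galerkin_b_mem_upperPart U hxk
    have ha1 : ∀ w ∈ U, P.a (τ k) w = P.b (x (φ k)) w := fun w hw => P.a_galerkin U _ hw
    have h1 : P.a (x (φ k)) (x (φ k)) = 1 := by rw [← aNorm_sq, (hx (φ k)).2, one_pow]
    have h2 : P.b (x (φ k)) (x (φ k)) = y (φ k) := hxy (φ k)
    -- `a(τ,τ)² = b(x,τ)² ≤ b(x,x) b(τ,τ) ≤ m · m a(τ,τ)`.
    have h3 : P.a (τ k) (τ k) ≤ m ^ 2 := by
      have e1 := P.b_sq_le (x (φ k)) (τ k)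
      have e2 := hle _ hxk
      have e3 := hle _ hτF
      rw [← ha1 _ hτF.1] at e1
      rw [h1] at e2
      have e4 : P.b (x (φ k)) (x (φ k)) * P.b (τ k) (τ k) ≤ (m * 1) * (m * P.a (τ k) (τ k)) :=
        mul_le_mul e2 e3 (P.b_nonneg _) (by positivity)
      rcases (P.a_nonneg (τ k)).eq_or_lt with h0 | h0
      · rw [← h0]; positivity
      · nlinarith
    rw [aNorm_sq]
    simp only [map_sub, map_smul, sub_apply, smul_apply, smul_eq_mul, P.a_symm (x (φ k)) (τ k),
      ha1 _ hxk.1, h1, h2]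
    simp only [ha1 _ hτF.1] at h3 ⊢
    linarith
  have h0 : Filter.Tendsto (fun k => P.aNorm (τ k - m • x (φ k)) ^ 2) Filter.atTop (nhds 0) := by
    refine squeeze_zero (fun k => sq_nonneg _) hsq ?_
    have := (hy'.const_mul (2 * m)).const_sub (2 * m ^ 2)
    rwa [← hm, show 2 * m ^ 2 - 2 * m * m = 0 by ring] at this
  have h0' : Filter.Tendsto (fun k => P.aNorm (τ k - m • x (φ k))) Filter.atTop (nhds 0) := by
    have := h0.sqrt
    simpa [Real.sqrt_sq (P.aNorm_nonneg _)] using this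
  have h0'' : Filter.Tendsto (fun k => τ k - m • x (φ k)) Filter.atTop (nhds 0) := by
    obtain ⟨K', hK', hn⟩ := P.exists_norm_le_aNorm
    refine squeeze_zero_norm (fun k => hn _) ?_
    simpa using h0'.const_mul K'
  have hxt : Filter.Tendsto (fun k => x (φ k)) Filter.atTop (nhds (m⁻¹ • t)) := by
    have h1 := (ht.sub h0'').const_smul m⁻¹
    simpa [smul_smul, inv_mul_cancel₀ hm0.ne'] using h1
  set w := m⁻¹ • t with hw
  have hwF : w ∈ F := (P.isClosed_upperPart U ρ).mem_of_tendsto hxt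
    (Filter.Eventually.of_forall fun k => (hx (φ k)).1)
  have hw1 : P.aNorm w = 1 := by
    refine tendsto_nhds_unique ((P.continuous_aNorm.tendsto w).comp hxt) ?_
    have : (P.aNorm ∘ fun k => x (φ k)) = fun _ => (1 : ℝ) := funext fun k => (hx (φ k)).2
    rw [this]
    exact tendsto_const_nhds
  have hw0 : w ≠ 0 := fun h => by
    rw [h, aNorm_zero] at hw1
    exact zero_ne_one hw1
  refine ⟨w, hwF, m⁻¹, ⟨hwF.1, hw0, fun z hz => ?_⟩, ?_⟩
  · have h1 : Filter.Tendsto (fun k => P.a (τ k) z) Filter.atTop (nhds (P.a t z)) :=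
      (((P.a.flip z).continuous.tendsto t).comp ht)
    have h2 : Filter.Tendsto (fun k => P.a (τ k) z) Filter.atTop (nhds (P.b w z)) := by
      have : (fun k => P.a (τ k) z) = fun k => P.b (x (φ k)) z :=
        funext fun k => P.a_galerkin U _ hz
      rw [this]
      exact (((P.b.flip z).continuous.tendsto w).comp hxt)
    rw [tendsto_nhds_unique h2 h1, hw, map_smul, smul_apply, smul_eq_mul]
  · rw [inv_mul_le_iff₀ hm0]
    exact hle v hv

/-- The extremal eigenvector lies in `upperPart`, so an eigenvalue below `ρ` would make it
orthogonal to itself. -/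
theorem mul_b_le_a_of_mem_upperPart (P : EigenProblem V) (U : Submodule ℝ V) [CompleteSpace U]
    (ρ : ℝ) {v : V} (hv : v ∈ P.upperPart U ρ) : ρ * P.b v v ≤ P.a v v := by
  by_cases hv0 : v = 0
  · simp [hv0]
  obtain ⟨w, hw, ν, hν, hle⟩ := P.exists_isEigenpair_upperPart U ρ hv hv0
  refine le_trans (mul_le_mul_of_nonneg_right ?_ (P.b_nonneg v)) hle
  by_contra! h
  exact hν.2.1 (P.eq_zero_of_a_self (hw.2 ν h w hν))

/-- On a span of eigenvectors with eigenvalue at most `ρ` the Rayleigh quotient is at most `ρ`. -/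
theorem a_le_mul_b_of_mem_span (P : EigenProblem V) (U : Submodule ℝ V) (ρ : ℝ) {v : V}
    (hv : v ∈ Submodule.span ℝ {w : V | ∃ ν ≤ ρ, P.IsEigenpair U ν w}) :
    P.a v v ≤ ρ * P.b v v := by
  -- Grouping by eigenvalue makes the components of `v` mutually `b`-orthogonal, so both forms
  -- become diagonal sums.
  let E : Set.Iic ρ → Submodule ℝ V := fun ν =>
    { carrier := {w | w ∈ U ∧ ∀ z ∈ U, P.a w z = ν * P.b w z}
      add_mem' := fun {x y} hx hy => ⟨U.add_mem hx.1 hy.1, fun z hz => by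
        simp only [map_add, add_apply, hx.2 z hz, hy.2 z hz]; ring⟩
      zero_mem' := ⟨U.zero_mem, fun z hz => by simp⟩
      smul_mem' := fun t x hx => ⟨U.smul_mem t hx.1, fun z hz => by
        simp only [map_smul, smul_apply, smul_eq_mul, hx.2 z hz]; ring⟩ }
  have hvE : v ∈ ⨆ ν, E ν := by
    refine (Submodule.span_le.2 ?_) hv
    rintro w ⟨ν, hν, hw⟩
    exact Submodule.mem_iSup_of_mem (⟨ν, hν⟩ : Set.Iic ρ) ⟨hw.1, hw.2.2⟩
  obtain ⟨f, hf, hfv⟩ := (Submodule.mem_iSup_iff_exists_finsupp E v).1 hvE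
  have horth : ∀ ν ν', ν ≠ ν' → P.b (f ν) (f ν') = 0 := by
    intro ν ν' hne
    by_cases h0 : f ν = 0
    · simp [h0]
    by_cases h0' : f ν' = 0
    · simp [h0']
    exact IsEigenpair.b_eq_zero ⟨(hf ν).1, h0, (hf ν).2⟩ ⟨(hf ν').1, h0', (hf ν').2⟩
      (fun h => hne (Subtype.ext h))
  have hb : P.b v v = ∑ ν ∈ f.support, P.b (f ν) (f ν) := by
    rw [← hfv, Finsupp.sum]
    simp only [map_sum, sum_apply]
    refine Finset.sum_congr rfl fun ν hν => ?_
    exact Finset.sum_eq_single_of_mem ν hν fun ν' _ hne => horth _ _ hne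
  have ha : P.a v v = ∑ ν ∈ f.support, ν * P.b (f ν) (f ν) := by
    rw [← hfv, Finsupp.sum]
    simp only [map_sum, sum_apply]
    refine Finset.sum_congr rfl fun ν hν => ?_
    rw [Finset.sum_eq_single_of_mem ν hν, (hf ν).2 _ (hf ν).1]
    intro ν' _ hne
    rw [(hf ν').2 _ (hf ν).1, horth _ _ hne, mul_zero]
  rw [ha, hb, Finset.mul_sum]
  exact Finset.sum_le_sum fun ν _ => mul_le_mul_of_nonneg_right ν.2 (P.b_nonneg _)

/-- A subspace of larger dimension contains a nonzero element energy-orthogonal to the smaller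
one. -/
theorem exists_a_orthogonal (P : EigenProblem V) (S E : Submodule ℝ V) [FiniteDimensional ℝ S]
    [FiniteDimensional ℝ E] (h : Module.finrank ℝ S < Module.finrank ℝ E) :
    ∃ e ∈ E, e ≠ 0 ∧ ∀ s ∈ S, P.a s e = 0 := by
  let L : E →ₗ[ℝ] (S →ₗ[ℝ] ℝ) :=
    { toFun := fun e => (P.a (e : V)).toLinearMap.comp S.subtype
      map_add' := fun x y => by ext s; simp
      map_smul' := fun t x => by ext s; simp }
  have hk : LinearMap.ker L ≠ ⊥ := by
    apply LinearMap.ker_ne_bot_of_finrank_lt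
    rwa [show Module.finrank ℝ (S →ₗ[ℝ] ℝ) = Module.finrank ℝ S from
      Subspace.dual_finrank_eq]
  obtain ⟨e, he, he0⟩ := (Submodule.ne_bot_iff _).1 hk
  refine ⟨e, e.2, fun h => he0 (Subtype.ext h), fun s hs => ?_⟩
  rw [P.a_symm]
  exact LinearMap.congr_fun (LinearMap.mem_ker.1 he) ⟨s, hs⟩

section
variable [CompleteSpace V]

theorem isEigenpair_top_iff (P : EigenProblem V) {ν : ℝ} (hν : ν ≠ 0) (w : V) :
    P.IsEigenpair ⊤ ν w ↔ w ≠ 0 ∧ P.T w = ν⁻¹ • w := by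
  constructor
  · rintro ⟨-, h0, h⟩
    refine ⟨h0, P.T_eq_of_a fun v => ?_⟩
    rw [map_smul, smul_apply, h v trivial, smul_eq_mul, inv_mul_cancel_left₀ hν]
  · rintro ⟨h0, h⟩
    refine ⟨trivial, h0, fun v _ => ?_⟩
    rw [← P.a_T, h, map_smul, smul_apply, smul_eq_mul, mul_inv_cancel_left₀ hν]

/-- For a simple eigenvalue, `T - λ⁻¹` is bounded below on the complement of the eigenvector. -/
theorem exists_gap (P : EigenProblem V) {lam : ℝ} {u : V} (hu : P.IsEigenpair ⊤ lam u)
    (hsimple : P.IsSimple lam) :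
    ∃ γ > 0, ∀ v, P.a v u = 0 → γ * P.aNorm v ≤ P.aNorm (P.T v - lam⁻¹ • v) := by
  -- Otherwise unit vectors `x k ⟂ u` satisfy `T x - λ⁻¹ x → 0`. Since `T x` converges along a
  -- subsequence, so does `x`, and the limit is a unit eigenvector for `λ` orthogonal to `u`,
  -- against simplicity.
  by_contra! hcon
  have hlam := hu.pos
  have hseq : ∀ k : ℕ, ∃ v, P.a v u = 0 ∧ P.aNorm v = 1 ∧
      P.aNorm (P.T v - lam⁻¹ • v) ≤ 1 / ((k : ℝ) + 1) := by
    intro k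
    obtain ⟨v, hv, hlt⟩ := hcon (1 / ((k : ℝ) + 1)) (by positivity)
    have hv0 : 0 < P.aNorm v := by
      refine (P.aNorm_nonneg v).lt_of_ne fun h => ?_
      rw [P.eq_zero_of_aNorm h.symm, aNorm_zero, mul_zero] at hlt
      exact absurd hlt (not_lt.2 (P.aNorm_nonneg _))
    refine ⟨(P.aNorm v)⁻¹ • v, by simp [hv], ?_, ?_⟩
    · rw [aNorm_smul, abs_of_pos (inv_pos.2 hv0), inv_mul_cancel₀ hv0.ne']
    · rw [T_smul, smul_comm, ← smul_sub, aNorm_smul, abs_of_pos (inv_pos.2 hv0),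
        inv_mul_le_iff₀ hv0, mul_comm]
      exact hlt.le
  choose x hxu hx1 hxT using hseq
  obtain ⟨t, φ, hφ, ht⟩ := P.exists_subseq_tendsto_galerkin ⊤ (v := x) (R := 1)
    (fun k => (hx1 k).le)
  simp only [galerkin_b_top] at ht
  have h0 : Filter.Tendsto (fun k => P.T (x (φ k)) - lam⁻¹ • x (φ k)) Filter.atTop (nhds 0) := by
    obtain ⟨K', hK', hn⟩ := P.exists_norm_le_aNorm
    refine squeeze_zero_norm (fun k => (hn _).trans
      (mul_le_mul_of_nonneg_left (hxT (φ k)) hK'.le)) ?_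
    simpa using ((tendsto_one_div_add_atTop_nhds_zero_nat (𝕜 := ℝ)).comp
      hφ.tendsto_atTop).const_mul K'
  have hxt : Filter.Tendsto (fun k => x (φ k)) Filter.atTop (nhds (lam • t)) := by
    have h1 := (ht.sub h0).const_smul lam
    simpa [smul_smul, mul_inv_cancel₀ hlam.ne'] using h1
  set w := lam • t with hw
  have hw1 : P.aNorm w = 1 := by
    refine tendsto_nhds_unique ((P.continuous_aNorm.tendsto w).comp hxt) ?_
    have : (P.aNorm ∘ fun k => x (φ k)) = fun _ => (1 : ℝ) := funext fun k => hx1 (φ k)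
    rw [this]
    exact tendsto_const_nhds
  have hwu : P.a w u = 0 := by
    refine tendsto_nhds_unique (((P.a.flip u).continuous.tendsto w).comp hxt) ?_
    have : ((P.a.flip u) ∘ fun k => x (φ k)) = fun _ => (0 : ℝ) := funext fun k => hxu (φ k)
    rw [this]
    exact tendsto_const_nhds
  have hw0 : w ≠ 0 := fun h => by
    rw [h, aNorm_zero] at hw1
    exact zero_ne_one hw1
  have hTw : P.T w = lam⁻¹ • w := by
    refine P.T_eq_of_a fun v => ?_
    have h1 := ((P.a.flip v).continuous.tendsto t).comp ht
    have h2 := ((P.b.flip v).continuous.tendsto w).comp hxt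
    have h3 : ((P.a.flip v) ∘ fun k => P.T (x (φ k))) = ((P.b.flip v) ∘ fun k => x (φ k)) :=
      funext fun k => P.a_T _ _
    rw [h3] at h1
    rw [hw, smul_smul, inv_mul_cancel₀ hlam.ne', one_smul]
    exact tendsto_nhds_unique h1 h2
  obtain ⟨u', -, hall⟩ := hsimple
  obtain ⟨c, hc⟩ := hall u hu
  obtain ⟨d, hd⟩ := hall w ((P.isEigenpair_top_iff hlam.ne' w).2 ⟨hw0, hTw⟩)
  have hc0 : c ≠ 0 := fun h => hu.2.1 (by rw [hc, h, zero_smul])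
  have hwc : w = (d * c⁻¹) • u := by rw [hc, hd, smul_smul, mul_assoc, inv_mul_cancel₀ hc0, mul_one]
  apply hw0
  apply P.eq_zero_of_a_self
  calc P.a w w = P.a w ((d * c⁻¹) • u) := by rw [← hwc]
    _ = 0 := by rw [map_smul, hwu, smul_zero]

end

/-! ### Comparison of exact and discrete eigenvalues -/

/-- `finrank` is `0` in infinite dimension, so a positive value forces finiteness. -/
theorem IsNthEigenvalue.finiteDimensional_le {P : EigenProblem V} {U : Submodule ℝ V} {i : ℕ}
    {lam : ℝ} (h : P.IsNthEigenvalue U i lam) :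
    FiniteDimensional ℝ (Submodule.span ℝ {w : V | ∃ ν ≤ lam, P.IsEigenpair U ν w}) :=
  Module.finite_of_finrank_pos (lt_of_lt_of_le (Nat.zero_lt_of_lt h.1) h.2)

theorem span_lt_le_span_le (P : EigenProblem V) (U : Submodule ℝ V) (lam : ℝ) :
    Submodule.span ℝ {w : V | ∃ ν < lam, P.IsEigenpair U ν w} ≤
      Submodule.span ℝ {w : V | ∃ ν ≤ lam, P.IsEigenpair U ν w} :=
  Submodule.span_mono fun _ ⟨ν, hν, hw⟩ => ⟨ν, hν.le, hw⟩

/-- There is a nonzero vector in the span of the eigenvectors on `U` with eigenvalue `≤ lam` that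
is orthogonal to those on `U'` with eigenvalue `< lam'`. -/
theorem IsNthEigenvalue.exists_orthogonal {P : EigenProblem V} {U U' : Submodule ℝ V} {i : ℕ}
    {lam lam' : ℝ} (h : P.IsNthEigenvalue U i lam) (h' : P.IsNthEigenvalue U' i lam') :
    ∃ e ∈ Submodule.span ℝ {w : V | ∃ ν ≤ lam, P.IsEigenpair U ν w}, e ≠ 0 ∧
      ∀ ν < lam', ∀ s, P.IsEigenpair U' ν s → P.a s e = 0 := by
  have := h.finiteDimensional_le
  have := h'.finiteDimensional_le
  have := Submodule.finiteDimensional_of_le (P.span_lt_le_span_le U' lam')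
  obtain ⟨e, he, he0, hs⟩ := P.exists_a_orthogonal _ _ (h'.1.trans_le h.2)
  exact ⟨e, he, he0, fun ν hν s hsν => hs s (Submodule.subset_span ⟨ν, hν, hsν⟩)⟩

/-- Min-max: some `e ≠ 0` in the discrete span up to `ν` is orthogonal to the exact eigenvectors
below `lam`, so its Rayleigh quotient is at most `ν` and at least `lam`. -/
theorem IsNthEigenvalue.le_of_top [CompleteSpace V] {P : EigenProblem V} {W : Submodule ℝ V}
    {i : ℕ} {lam ν : ℝ} (h : P.IsNthEigenvalue ⊤ i lam) (hW : P.IsNthEigenvalue W i ν) :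
    lam ≤ ν := by
  obtain ⟨e, he, he0, hs⟩ := hW.exists_orthogonal h
  have h1 := P.mul_b_le_a_of_mem_upperPart ⊤ lam (v := e) ⟨trivial, hs⟩
  have h2 := P.a_le_mul_b_of_mem_span W ν he
  exact le_of_mul_le_mul_right (h1.trans h2) (P.b_pos e he0)

/-- The reverse comparison, by projecting a suitable exact `e` to `W`: the energy does not grow,
orthogonality to the lower discrete eigenvectors is kept, and `b(e,e)` drops by at most `2η a(e,e)`.
-/
theorem IsNthEigenvalue.inv_sub_le [CompleteSpace V] {P : EigenProblem V} {W : Submodule ℝ V}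
    [CompleteSpace W] {i : ℕ} {lam ν η : ℝ} (h : P.IsNthEigenvalue ⊤ i lam) (hlam : 0 < lam)
    (hW : P.IsNthEigenvalue W i ν) (hν : 0 < ν)
    (hη : ∀ f, P.aNorm (P.T f - P.proj W (P.T f)) ≤ η * P.aNorm f) :
    lam⁻¹ - 2 * η ≤ ν⁻¹ := by
  obtain ⟨e, he, he0, hs⟩ := h.exists_orthogonal hW
  set p := P.proj W e with hp
  have hpW := P.proj_mem W e
  have h1 := P.mul_b_le_a_of_mem_upperPart W ν (v := p) ⟨hpW, fun ν' hν' s hsν => by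
    rw [P.a_symm, hp, P.a_proj W e hsν.1, P.a_symm, hs ν' hν' s hsν]⟩
  have h2 := P.a_le_mul_b_of_mem_span ⊤ lam he
  have h3 : P.a p p ≤ P.a e e := by
    rw [← aNorm_sq, ← aNorm_sq]
    exact pow_le_pow_left₀ (P.aNorm_nonneg _) (P.aNorm_proj_le W e) 2
  have h4 : P.b e (e - p) ≤ η * P.a e e := by
    -- Galerkin orthogonality lets an element of `W` be subtracted from `T e`; this produces the
    -- factor `η`.
    have e1 : P.b e (e - p) = P.a (P.T e - P.proj W (P.T e)) (e - p) := by
      rw [map_sub P.a, sub_apply, P.a_T, P.a_symm (P.proj W (P.T e)),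
        P.a_sub_proj W e (P.proj_mem W _), sub_zero]
    have e2 := P.a_le (P.T e - P.proj W (P.T e)) (e - p)
    have e3 := P.aNorm_sub_proj_le W e W.zero_mem
    rw [sub_zero, ← hp] at e3
    rw [e1, ← aNorm_sq, pow_two, ← mul_assoc]
    exact e2.trans (mul_le_mul (hη e) e3 (P.aNorm_nonneg _)
      ((P.aNorm_nonneg _).trans (hη e)))
  have h5 : P.b p p = P.b e e - 2 * P.b e (e - p) + P.b (e - p) (e - p) := by
    simp only [map_sub, sub_apply, P.b_symm p e]
    ring
  have h6 := P.b_nonneg (e - p)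
  have h7 : 0 < P.a e e := (P.a_nonneg e).lt_of_ne fun h => he0 (P.eq_zero_of_a_self h.symm)
  have h8 : lam⁻¹ * P.a e e ≤ P.b e e := by rwa [inv_mul_le_iff₀ hlam]
  have h9 : P.b p p ≤ ν⁻¹ * P.a e e := by
    rw [le_inv_mul_iff₀ hν]
    linarith
  refine le_of_mul_le_mul_right ?_ h7
  linarith

/-! ### Error estimates for a discrete eigenpair -/

section
variable [CompleteSpace V]

/-- The Aubin–Nitsche argument: `‖Tz‖_a² = a(T(Tz), z)`, and `z` is orthogonal to `W`, so `T(Tz)`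
may be replaced by its projection error. -/
theorem aNorm_T_sub_proj_le_of_approx (P : EigenProblem V) {W : Submodule ℝ V} [CompleteSpace W]
    {η : ℝ} (hη : ∀ f, P.aNorm (P.T f - P.proj W (P.T f)) ≤ η * P.aNorm f) (hη0 : 0 ≤ η) (x : V) :
    P.aNorm (P.T (x - P.proj W x)) ≤ η * P.aNorm (x - P.proj W x) := by
  set z := x - P.proj W x with hz
  apply P.aNorm_le_of_sq_le (mul_nonneg hη0 (P.aNorm_nonneg _))
  have h1 : P.a (P.T z) (P.T z) = P.a (P.T (P.T z) - P.proj W (P.T (P.T z))) z := by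
    rw [map_sub P.a, sub_apply, P.a_symm (P.proj W _) z, hz, P.a_sub_proj W x (P.proj_mem W _),
      sub_zero, P.a_T_comm (P.T _)]
  rw [h1]
  calc _ ≤ _ := P.a_le _ _
    _ ≤ (η * P.aNorm (P.T z)) * P.aNorm z :=
      mul_le_mul_of_nonneg_right (hη _) (P.aNorm_nonneg _)
    _ = _ := by ring

theorem T_eigenvector (P : EigenProblem V) {lam : ℝ} {u : V} (hu : P.IsEigenpair ⊤ lam u) :
    P.T u = lam⁻¹ • u := ((P.isEigenpair_top_iff hu.pos.ne' u).1 hu).2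

/-- Since `u = λ T u`, the definition of `η` applies to `u` itself. -/
theorem aNorm_sub_proj_eigenvector_le (P : EigenProblem V) {W : Submodule ℝ V} [CompleteSpace W]
    {η lam : ℝ} {u : V} (hu : P.IsEigenpair ⊤ lam u)
    (hη : ∀ f, P.aNorm (P.T f - P.proj W (P.T f)) ≤ η * P.aNorm f) :
    P.aNorm (u - P.proj W u) ≤ lam * η * P.aNorm u := by
  have h1 : u = lam • P.T u := by
    rw [P.T_eigenvector hu, smul_smul, mul_inv_cancel₀ hu.pos.ne', one_smul]
  have h2 := P.aNorm_sub_proj_le W u (W.smul_mem lam (P.proj_mem W (P.T u)))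
  have h3 : P.aNorm (u - lam • P.proj W (P.T u)) = lam * P.aNorm (P.T u - P.proj W (P.T u)) := by
    rw [← abs_of_pos hu.pos, ← aNorm_smul, abs_of_pos hu.pos, smul_sub, ← h1]
  rw [h3] at h2
  rw [mul_assoc]
  exact h2.trans (mul_le_mul_of_nonneg_left (hη u) hu.pos.le)

/-- A discrete eigenpair `(ν, w)` on `W` close enough to the exact simple one `(lam, u)`. -/
structure IsCloseEigenpair (P : EigenProblem V) (lam : ℝ) (u : V) (γ η : ℝ) (W : Submodule ℝ V)
    [CompleteSpace W] (ν : ℝ) (w : V) : Prop where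
  exact : P.IsEigenpair ⊤ lam u
  b_exact : P.b u u = 1
  discrete : P.IsEigenpair W ν w
  b_discrete : P.b w w = 1
  gap_pos : 0 < γ
  gap : ∀ v, P.a v u = 0 → γ * P.aNorm v ≤ P.aNorm (P.T v - lam⁻¹ • v)
  approx_nonneg : 0 ≤ η
  approx : ∀ f, P.aNorm (P.T f - P.proj W (P.T f)) ≤ η * P.aNorm f
  approx_le : 36 * η ≤ γ
  lower : lam ≤ ν
  upper : ν ≤ 2 * lam
  inv_sub_le : lam⁻¹ - 2 * η ≤ ν⁻¹

namespace IsCloseEigenpair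

variable {P : EigenProblem V} {lam : ℝ} {u : V} {γ η : ℝ} {W : Submodule ℝ V} [CompleteSpace W]
  {ν : ℝ} {w : V}

theorem aNorm_exact_sq (h : P.IsCloseEigenpair lam u γ η W ν w) : P.aNorm u ^ 2 = lam := by
  rw [aNorm_sq, h.exact.2.2 u trivial, h.b_exact, mul_one]

theorem aNorm_discrete_sq (h : P.IsCloseEigenpair lam u γ η W ν w) : P.aNorm w ^ 2 = ν := by
  rw [aNorm_sq, h.discrete.2.2 w h.discrete.1, h.b_discrete, mul_one]

theorem aNorm_exact_pos (h : P.IsCloseEigenpair lam u γ η W ν w) : 0 < P.aNorm u := by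
  have h1 := h.aNorm_exact_sq
  have h2 := h.exact.pos
  refine (P.aNorm_nonneg u).lt_of_ne fun h3 => ?_
  rw [← h3] at h1
  norm_num at h1
  linarith

theorem aNorm_discrete_le (h : P.IsCloseEigenpair lam u γ η W ν w) :
    P.aNorm w ≤ 3 / 2 * P.aNorm u := by
  apply le_of_sq_le_sq _ (by have := P.aNorm_nonneg u; positivity)
  rw [mul_pow, h.aNorm_discrete_sq, h.aNorm_exact_sq]
  linarith [h.upper, h.exact.pos]

theorem a_sub_eq_zero (h : P.IsCloseEigenpair lam u γ η W ν w) :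
    P.a (w - P.b w u • u) u = 0 := by
  simp only [map_sub, map_smul, sub_apply, smul_apply, smul_eq_mul]
  rw [P.a_symm w u, h.exact.2.2 w trivial, h.exact.2.2 u trivial, h.b_exact, P.b_symm w u]
  ring

/-- The component of the discrete eigenvector orthogonal to the exact one is small. -/
theorem aNorm_sub_le (h : P.IsCloseEigenpair lam u γ η W ν w) :
    12 * P.aNorm (w - P.b w u • u) ≤ P.aNorm w := by
  have hν := h.discrete.pos
  set g := w - P.b w u • u with hg
  -- `T - λ⁻¹` kills the `u`-component. The residual of `w` is at most `η‖w‖ + 2η‖w‖`, and `36η ≤ γ`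
  -- turns `3η` into `γ/12`.
  have h1 : P.T g - lam⁻¹ • g = P.T w - lam⁻¹ • w := by
    rw [hg, T_sub, T_smul, P.T_eigenvector h.exact]
    module
  have h2 := h.gap g h.a_sub_eq_zero
  rw [h1] at h2
  have h3 : P.proj W (P.T w) = ν⁻¹ • w :=
    P.eq_of_a_eq (P.proj_mem W _) (W.smul_mem _ h.discrete.1) fun v hv => by
      rw [P.a_proj W _ hv, a_T, map_smul, smul_apply, h.discrete.2.2 v hv, smul_eq_mul,
        inv_mul_cancel_left₀ hν.ne']
  have h4 : P.T w - lam⁻¹ • w = (P.T w - P.proj W (P.T w)) + (ν⁻¹ - lam⁻¹) • w := by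
    rw [h3]
    module
  have h5 : |ν⁻¹ - lam⁻¹| ≤ 2 * η := by
    have e1 := h.inv_sub_le
    have e2 := inv_anti₀ h.exact.pos h.lower
    rw [abs_le]
    constructor <;> linarith [h.approx_nonneg]
  have h6 := P.aNorm_add_le (P.T w - P.proj W (P.T w)) ((ν⁻¹ - lam⁻¹) • w)
  rw [← h4, aNorm_smul] at h6
  have h7 := h.approx w
  have h8 := mul_le_mul_of_nonneg_right h5 (P.aNorm_nonneg w)
  have h9 := mul_le_mul_of_nonneg_right h.approx_le (P.aNorm_nonneg w)
  refine le_of_mul_le_mul_left ?_ h.gap_pos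
  linarith

/-- Pythagoras: `ν = c²λ + ‖g‖_a²` with `‖g‖_a² ≤ ν/144` and `ν ≥ λ`. -/
theorem half_le_abs_b (h : P.IsCloseEigenpair lam u γ η W ν w) : 1 / 2 ≤ |P.b w u| := by
  have hg := h.a_sub_eq_zero
  have hs := h.aNorm_sub_le
  have hlam := h.exact.pos
  set c := P.b w u
  set g := w - c • u with hgdef
  have h1 : P.a w w = c ^ 2 * lam + P.a g g := by
    have e1 : w = g + c • u := by rw [hgdef]; abel
    have e2 : P.a u u = lam := by rw [← aNorm_sq, h.aNorm_exact_sq]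
    calc P.a w w = P.a (g + c • u) (g + c • u) := by rw [← e1]
      _ = _ := by
        simp only [map_add, map_smul, add_apply, smul_apply, smul_eq_mul, P.a_symm u g, hg, e2]
        ring
  rw [← aNorm_sq, ← aNorm_sq, h.aNorm_discrete_sq] at h1
  have h2 : (12 * P.aNorm g) ^ 2 ≤ P.aNorm w ^ 2 :=
    pow_le_pow_left₀ (by have := P.aNorm_nonneg g; positivity) hs 2
  rw [mul_pow, h.aNorm_discrete_sq] at h2
  have h3 : (1 / 2 : ℝ) ^ 2 ≤ |c| ^ 2 := by
    rw [sq_abs]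
    refine le_of_mul_le_mul_right ?_ hlam
    linarith [h.lower]
  exact le_of_sq_le_sq h3 (abs_nonneg c)

/-- Stability of the discrete problem on the complement of the discrete eigenvector. -/
theorem gap_discrete (h : P.IsCloseEigenpair lam u γ η W ν w) {r : V} (hr : P.a r w = 0) :
    γ / 2 * P.aNorm r ≤ P.aNorm (P.proj W (P.T r) - lam⁻¹ • r) := by
  have hlam := h.exact.pos
  have hu := h.aNorm_exact_pos
  have hu2 := h.aNorm_exact_sq
  have hr0 := P.aNorm_nonneg r
  -- As `r ⟂ w`, only `w - b(w,u)u` contributes; its norm is at most `‖w‖_a/12 ≤ ‖u‖_a/8`, and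
  -- dividing by `|b(w,u)| ≥ 1/2` gives `1/4`. So `r` is nearly orthogonal to `u` and the exact gap
  -- applies.
  have h1 : |P.a r u| ≤ P.aNorm r * P.aNorm u / 4 := by
    have e1 : P.b w u * P.a r u = - P.a r (w - P.b w u • u) := by
      simp only [map_sub, map_smul, smul_eq_mul, hr]
      ring
    have e2 := P.abs_a_le r (w - P.b w u • u)
    rw [← abs_neg, ← e1, abs_mul] at e2
    have e3 := mul_le_mul_of_nonneg_right h.half_le_abs_b (abs_nonneg (P.a r u))
    have e4 := mul_le_mul_of_nonneg_left h.aNorm_sub_le hr0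
    have e5 := mul_le_mul_of_nonneg_left h.aNorm_discrete_le hr0
    linarith
  set s := P.a r u / lam with hs
  have h2 : P.aNorm (s • u) ≤ P.aNorm r / 4 := by
    rw [aNorm_smul, hs, abs_div, abs_of_pos hlam, ← hu2, div_mul_eq_mul_div,
      div_le_iff₀ (by positivity)]
    nlinarith
  have h3 : P.a (r - s • u) u = 0 := by
    have : P.a u u = lam := by rw [← aNorm_sq, hu2]
    simp only [map_sub, map_smul, sub_apply, smul_apply, smul_eq_mul, this, hs]
    field_simp
    ring
  have h4 : P.aNorm r ≤ P.aNorm (r - s • u) + P.aNorm (s • u) := by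
    simpa using P.aNorm_add_le (r - s • u) (s • u)
  have h5 := h.gap _ h3
  have h6 : P.T (r - s • u) - lam⁻¹ • (r - s • u) = P.T r - lam⁻¹ • r := by
    rw [T_sub, T_smul, P.T_eigenvector h.exact]
    module
  rw [h6] at h5
  have h7 : P.aNorm (P.T r - lam⁻¹ • r) ≤
      P.aNorm (P.T r - P.proj W (P.T r)) + P.aNorm (P.proj W (P.T r) - lam⁻¹ • r) := by
    simpa using P.aNorm_add_le (P.T r - P.proj W (P.T r)) (P.proj W (P.T r) - lam⁻¹ • r)
  have h8 := h.approx r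
  have h9 := mul_le_mul_of_nonneg_right h.approx_le hr0
  have h10 : γ * (3 / 4 * P.aNorm r) ≤ γ * P.aNorm (r - s • u) :=
    mul_le_mul_of_nonneg_left (by linarith) h.gap_pos.le
  have h11 := mul_nonneg h.gap_pos.le hr0
  linarith

/-- The part of the projected exact eigenvector orthogonal to the discrete eigenvector is of
higher order. -/
theorem aNorm_proj_sub_le (h : P.IsCloseEigenpair lam u γ η W ν w) :
    γ / 2 * P.aNorm (P.proj W u - (P.a u w / ν) • w) ≤ η * P.aNorm (u - P.proj W u) := by
  have hν := h.discrete.pos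
  have hwW := h.discrete.1
  set α := P.a u w / ν with hα
  set r := P.proj W u - α • w with hr
  have hrW : r ∈ W := W.sub_mem (P.proj_mem W u) (W.smul_mem _ hwW)
  have hrw : P.a r w = 0 := by
    simp only [hr, map_sub, map_smul, sub_apply, smul_apply, smul_eq_mul]
    rw [P.a_proj W u hwW, ← aNorm_sq, h.aNorm_discrete_sq, hα]
    field_simp
    ring
  have h0 : ∀ y ∈ W, P.a y w = 0 → P.b w y = 0 := fun y hy hyw => by
    rw [P.a_symm, h.discrete.2.2 y hy] at hyw
    exact (mul_eq_zero.1 hyw).resolve_left hν.ne'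
  refine (h.gap_discrete hrw).trans (le_trans ?_
    (P.aNorm_T_sub_proj_le_of_approx h.approx h.approx_nonneg u))
  set y := P.proj W (P.T r) - lam⁻¹ • r with hy
  have hyW : y ∈ W := W.sub_mem (P.proj_mem W _) (W.smul_mem _ hrW)
  have hyw : P.a y w = 0 := by
    simp only [hy, map_sub, map_smul, sub_apply, smul_apply, smul_eq_mul, hrw]
    rw [P.a_proj W _ hwW, a_T, P.b_symm, h0 r hrW hrw]
    ring
  have hTr : P.a (P.T r) y = lam⁻¹ * P.a u y - P.a (P.T (u - P.proj W u)) y := by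
    have e1 : r = u - (u - P.proj W u) - α • w := by rw [hr]; abel
    have e2 : P.T r = lam⁻¹ • u - P.T (u - P.proj W u) - α • P.T w := by
      conv_lhs => rw [e1]
      rw [T_sub, T_sub, T_smul, P.T_eigenvector h.exact]
    rw [e2]
    simp only [map_sub P.a, map_smul, sub_apply, smul_apply, smul_eq_mul]
    rw [P.a_T w y, h0 y hyW hyw]
    ring
  have hry : P.a r y = P.a u y := by
    simp only [hr, map_sub, map_smul, sub_apply, smul_apply, smul_eq_mul]
    rw [P.a_proj W u hyW, P.a_symm w y, hyw]
    ring
  apply P.aNorm_le_of_sq_le (P.aNorm_nonneg _)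
  -- `r` solves the discrete residual equation with data `-ΠT(u - Πu)`, up to multiples of `w`,
  -- which `y` annihilates.
  have hyy : P.a y y = - P.a (P.T (u - P.proj W u)) y := by
    have e1 : P.a y y = P.a (P.proj W (P.T r)) y - lam⁻¹ * P.a r y := by
      conv_lhs => rw [hy]
      rw [map_sub P.a, map_smul P.a, sub_apply, smul_apply, smul_eq_mul]
    rw [e1, P.a_proj W _ hyW, hTr, hry]
    ring
  rw [hyy]
  exact (neg_le_abs _).trans (P.abs_a_le _ _)

/-- The source data `ν w` and `lam u` agree up to sign and a higher-order error, in the norm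
`‖T ·‖_a`. -/
theorem exists_sign (h : P.IsCloseEigenpair lam u γ η W ν w) {K : ℝ} (hK : 0 < K)
    (hT : ∀ f, P.aNorm (P.T f) ≤ K * P.aNorm f) :
    ∃ σ : ℝ, (σ = 1 ∨ σ = -1) ∧ P.aNorm (P.T (ν • w - σ • lam • u)) ≤
      (96 * K * lam ^ 2 + lam * (1 + 2 * K / γ) * (1 + 6 * K * lam)) * η *
        P.aNorm (u - P.proj W u) := by
  have hlam := h.exact.pos
  have hν := h.discrete.pos
  have hγ := h.gap_pos
  have hη := h.approx_nonneg
  have hu2 := h.aNorm_exact_sq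
  have hu0 := h.aNorm_exact_pos
  have hwu := h.aNorm_discrete_le
  have hr := h.aNorm_proj_sub_le
  have hd1 := P.aNorm_sub_proj_eigenvector_le h.exact h.approx
  have hd2 : P.aNorm (u - P.proj W u) ≤ P.aNorm u := by
    simpa using P.aNorm_sub_proj_le W u W.zero_mem
  have hTd := P.aNorm_T_sub_proj_le_of_approx h.approx h.approx_nonneg u
  have hd0 := P.aNorm_nonneg (u - P.proj W u)
  set d := P.aNorm (u - P.proj W u) with hd
  -- As `a(w,w) = ν`, this `α • w` is the energy projection of `u` onto the line of `w`.
  set α := P.a u w / ν with hα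
  set r := P.proj W u - α • w with hrdef
  have hr' : P.aNorm r ≤ 2 / γ * (η * d) := by
    rw [div_mul_eq_mul_div, le_div_iff₀ hγ]
    linarith
  have hrd : P.aNorm r ≤ d := by
    refine le_of_mul_le_mul_left (hr.trans ?_) (half_pos hγ)
    exact mul_le_mul_of_nonneg_right (by linarith [h.approx_le]) hd0
  set e := u - α • w with he
  have her : e = (u - P.proj W u) + r := by rw [he, hrdef]; abel
  have hed : P.aNorm e ≤ 2 * d := by
    have := P.aNorm_add_le (u - P.proj W u) r
    rw [← her] at this
    linarith
  set C := 1 + 2 * K / γ with hC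
  have hC0 : 0 < C := by positivity
  have hTe : P.aNorm (P.T e) ≤ C * (η * d) := by
    have h1 := P.aNorm_add_le (P.T (u - P.proj W u)) (P.T r)
    rw [← T_add, ← her] at h1
    have h2 := (hT r).trans (mul_le_mul_of_nonneg_left hr' hK.le)
    calc _ ≤ η * d + K * (2 / γ * (η * d)) := by linarith
      _ = _ := by rw [hC]; ring
  have hα4 : 1 / 4 ≤ |α| := by
    have h1 := h.half_le_abs_b
    rw [hα, h.exact.2.2 w trivial, abs_div, abs_mul, abs_of_pos hν, abs_of_pos hlam,
      P.b_symm u w, le_div_iff₀ hν]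
    nlinarith [h.upper]
  have haw : α • w = u - e := by rw [he]; abel
  -- The form `a - λb` vanishes whenever one argument is `u`, so no first-order term in `e` remains.
  have hray : α ^ 2 * (ν - lam) = P.a e e - lam * P.b e e := by
    have e1 : P.a (α • w) (α • w) - lam * P.b (α • w) (α • w) = α ^ 2 * (ν - lam) := by
      simp only [map_smul, smul_apply, smul_eq_mul, h.b_discrete]
      rw [← aNorm_sq, h.aNorm_discrete_sq]
      ring
    rw [← e1, haw]
    simp only [map_sub, sub_apply, P.a_symm e u, P.b_symm e u, h.exact.2.2 _ trivial]
    ring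
  -- `α² ≥ 1/16`, `‖e‖_a² ≤ 4d²`, and one factor `d` is traded for `λη‖u‖_a`.
  have hνlam : ν - lam ≤ 64 * lam * P.aNorm u * (η * d) := by
    have e1 : (1 / 4) ^ 2 ≤ α ^ 2 := by
      rw [← sq_abs α]
      exact pow_le_pow_left₀ (by norm_num) hα4 2
    have e2 := mul_le_mul_of_nonneg_right e1 (sub_nonneg.2 h.lower)
    have e3 := mul_nonneg hlam.le (P.b_nonneg e)
    have e4 := pow_le_pow_left₀ (P.aNorm_nonneg e) hed 2
    rw [aNorm_sq] at e4
    have e5 := mul_le_mul_of_nonneg_right hd1 hd0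
    linarith
  -- Both normalizations are in `b`, so the defect `2b(e,u) - b(e,e)` involves `e` only through `T
  -- e`, which is of higher order.
  have hone : |1 - α ^ 2| ≤ 4 * P.aNorm u * (C * (η * d)) := by
    have e1 : 1 - α ^ 2 = 2 * P.a (P.T e) u - P.a (P.T e) e := by
      have : α ^ 2 = P.b (α • w) (α • w) := by
        simp only [map_smul, smul_apply, smul_eq_mul, h.b_discrete]
        ring
      rw [this, haw, a_T, a_T]
      simp only [map_sub, sub_apply, P.b_symm e u, h.b_exact]
      ring
    have e2 := P.abs_a_le (P.T e) u
    have e3 := P.abs_a_le (P.T e) e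
    have e4 : P.aNorm (P.T e) * P.aNorm u ≤ C * (η * d) * P.aNorm u :=
      mul_le_mul_of_nonneg_right hTe hu0.le
    have e5 : P.aNorm (P.T e) * P.aNorm e ≤ C * (η * d) * (2 * P.aNorm u) :=
      mul_le_mul hTe (by linarith) (P.aNorm_nonneg e) (by positivity)
    rw [e1]
    refine (abs_sub _ _).trans ?_
    rw [abs_mul, abs_two]
    linarith
  have hone' : |1 - (|α|)| ≤ 4 * P.aNorm u * (C * (η * d)) := by
    refine le_trans ?_ hone
    rw [← sq_abs α, show 1 - |α| ^ 2 = (1 - |α|) * (1 + |α|) by ring, abs_mul]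
    refine le_mul_of_one_le_right (abs_nonneg _) ?_
    rw [abs_of_pos (by positivity)]
    linarith [abs_nonneg α]
  obtain ⟨σ, hσ, hσα⟩ : ∃ σ : ℝ, (σ = 1 ∨ σ = -1) ∧ σ * α = |α| := by
    rcases le_total 0 α with h0 | h0
    · exact ⟨1, Or.inl rfl, by rw [abs_of_nonneg h0, one_mul]⟩
    · exact ⟨-1, Or.inr rfl, by rw [abs_of_nonpos h0, neg_one_mul]⟩
  have hσ1 : |σ| = 1 := by rcases hσ with rfl | rfl <;> simp
  refine ⟨σ, hσ, ?_⟩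
  have hsplit : ν • w - σ • lam • u
      = ((ν - lam) + lam * (1 - |α|)) • w - (lam * σ) • e := by
    rw [he, ← hσα]
    module
  have hTw : P.aNorm (P.T w) ≤ K * (3 / 2 * P.aNorm u) :=
    (hT w).trans (mul_le_mul_of_nonneg_left hwu hK.le)
  rw [hsplit, T_sub, T_smul, T_smul]
  have h1 : |(ν - lam) + lam * (1 - |α|)| ≤
      64 * lam * P.aNorm u * (η * d) + lam * (4 * P.aNorm u * (C * (η * d))) := by
    refine (abs_add_le _ _).trans ?_
    rw [abs_mul, abs_of_pos hlam, abs_of_nonneg (sub_nonneg.2 h.lower)]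
    exact add_le_add hνlam (mul_le_mul_of_nonneg_left hone' hlam.le)
  have h2 : P.aNorm (((ν - lam) + lam * (1 - |α|)) • P.T w) ≤
      (64 * lam * P.aNorm u * (η * d) + lam * (4 * P.aNorm u * (C * (η * d)))) *
        (K * (3 / 2 * P.aNorm u)) := by
    rw [aNorm_smul]
    exact mul_le_mul h1 hTw (P.aNorm_nonneg _) ((abs_nonneg _).trans h1)
  have h3 : P.aNorm ((lam * σ) • P.T e) ≤ lam * (C * (η * d)) := by
    rw [aNorm_smul, abs_mul, hσ1, mul_one, abs_of_pos hlam]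
    exact mul_le_mul_of_nonneg_left hTe hlam.le
  refine (P.aNorm_sub_le _ _).trans ((add_le_add h2 h3).trans (le_of_eq ?_))
  rw [← hu2]
  ring

end IsCloseEigenpair

/-- For every sufficiently rich finite-dimensional `W`, the `i`-th discrete eigenpair yields source
data approximating those of the exact eigenpair to higher order. -/
theorem exists_discrete_estimate (P : EigenProblem V) {i : ℕ} {lam : ℝ} {u : V}
    (hu : P.IsNthEigenpair ⊤ i lam u) (hsimple : P.IsSimple lam) :
    ∃ η₀ > (0 : ℝ), ∃ C > (0 : ℝ), ∀ (W : Submodule ℝ V) [CompleteSpace W] (η : ℝ), 0 ≤ η →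
      η ≤ η₀ → (∀ f, P.aNorm (P.T f - P.proj W (P.T f)) ≤ η * P.aNorm f) →
      ∀ ν w, P.IsNthEigenpair W i ν w →
        ∃ σ : ℝ, (σ = 1 ∨ σ = -1) ∧
          P.aNorm (P.T (ν • w - σ • lam • u)) ≤ C * η * P.aNorm (u - P.proj W u) := by
  obtain ⟨hun, hue, hub⟩ := hu
  have hlam := hue.pos
  obtain ⟨γ, hγ, hgap⟩ := P.exists_gap hue hsimple
  obtain ⟨K, hK, hT⟩ := P.exists_aNorm_T_le
  -- The first threshold yields `ν⁻¹ ≥ λ⁻¹/2`, that is `ν ≤ 2λ`; the second is the smallness against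
  -- the gap.
  refine ⟨min (lam⁻¹ / 4) (γ / 36), by positivity,
    96 * K * lam ^ 2 + lam * (1 + 2 * K / γ) * (1 + 6 * K * lam), by positivity, ?_⟩
  intro W _ η hη0 hη hη' ν w ⟨hwn, hwe, hwb⟩
  have hν := hwe.pos
  have h1 := hη.trans (min_le_left _ _)
  have h2 := hη.trans (min_le_right _ _)
  have h3 := hun.inv_sub_le hlam hwn hν hη'
  have h4 : ν ≤ 2 * lam := by
    have e1 : (2 * lam)⁻¹ ≤ ν⁻¹ := by
      rw [mul_inv]
      linarith
    exact (inv_le_inv₀ (by positivity) hν).1 e1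
  exact IsCloseEigenpair.exists_sign (γ := γ)
    { exact := hue, b_exact := hub, discrete := hwe, b_discrete := hwb, gap_pos := hγ, gap := hgap,
      approx_nonneg := hη0, approx := hη', approx_le := by linarith, lower := hun.le_of_top hwn,
      upper := h4, inv_sub_le := h3 } hK hT

end

/-! ### The multi-level correction scheme -/

/-- Simplicity reduces `M(λ)` to `{u, -u}`, and the distance to a subspace is even. -/
theorem delta_eq (P : EigenProblem V) {lam : ℝ} {u : V} (hu : P.IsEigenpair ⊤ lam u)
    (hub : P.b u u = 1) (hsimple : P.IsSimple lam) (U : Submodule ℝ V) [CompleteSpace U] :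
    P.delta lam U = P.aDist U u := by
  have hneg : P.aDist U (-u) = P.aDist U u := by
    have h : ∀ x, P.aDist U (-x) ≤ P.aDist U x := fun x => by
      rw [aDist_eq, aDist_eq]
      refine (P.aNorm_sub_proj_le U (-x) (U.neg_mem (P.proj_mem U x))).trans (le_of_eq ?_)
      rw [← P.aNorm_neg (x - P.proj U x)]
      congr 1
      abel
    refine le_antisymm (h u) ?_
    simpa using h (-u)
  have himage : (fun w => P.aDist U w) '' P.eigenSet lam = {P.aDist U u} := by
    refine Set.Subset.antisymm ?_ (Set.singleton_subset_iff.2 ⟨u, ⟨hu, hub⟩, rfl⟩)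
    rintro _ ⟨w, ⟨hw, hwb⟩, rfl⟩
    obtain ⟨u', -, hall⟩ := hsimple
    obtain ⟨c, hc⟩ := hall u hu
    obtain ⟨d, hd⟩ := hall w hw
    rw [hc] at hub
    rw [hd] at hwb
    simp only [map_smul, smul_apply, smul_eq_mul] at hub hwb
    have hu' : P.b u' u' ≠ 0 := fun h => by simp [h] at hub
    have hcd : d ^ 2 = c ^ 2 := mul_right_cancel₀ hu' (by linarith)
    rcases sq_eq_sq_iff_eq_or_eq_neg.1 hcd with h | h
    · rw [hd, h, ← hc]
      rfl
    · rw [hd, h, neg_smul, ← hc]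
      exact hneg
  rw [delta, himage, csSup_singleton]

theorem aDist_nonneg (P : EigenProblem V) (U : Submodule ℝ V) (x : V) : 0 ≤ P.aDist U x :=
  Real.iInf_nonneg fun _ => P.aNorm_nonneg _

theorem delta_nonneg (P : EigenProblem V) (lam : ℝ) (U : Submodule ℝ V) : 0 ≤ P.delta lam U :=
  Real.sSup_nonneg (by rintro _ ⟨w, -, rfl⟩; exact P.aDist_nonneg U w)

theorem aDist_le_of_mem (P : EigenProblem V) {W : Submodule ℝ V} [CompleteSpace W] {u x : V}
    {σ : ℝ} (hσ : σ = 1 ∨ σ = -1) (hx : x ∈ W) : P.aDist W u ≤ P.aNorm (x - σ • u) := by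
  rw [aDist_eq]
  refine (P.aNorm_sub_proj_le W u (W.smul_mem σ hx)).trans (le_of_eq ?_)
  rcases hσ with rfl | rfl
  · rw [one_smul, one_smul, aNorm_sub_comm]
  · congr 1
    module

/-- The Rayleigh quotient of an approximate eigenvector is accurate to second order. -/
theorem abs_rayleigh_sub_le (P : EigenProblem V) {lam σ K : ℝ} {u x : V}
    (hu : P.IsEigenpair ⊤ lam u) (hub : P.b u u = 1) (hσ : σ = 1 ∨ σ = -1)
    (hK : ∀ v w, P.b v w ≤ K * (P.aNorm v * P.aNorm w))
    (hx : 4 * (P.aNorm u * P.aNorm (x - σ • u)) ≤ lam) :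
    |P.a x x / P.b x x - lam| ≤ 2 * (1 + lam * K) * P.aNorm (x - σ • u) ^ 2 := by
  have hlam := hu.pos
  have hσ2 : σ ^ 2 = 1 := by rcases hσ with rfl | rfl <;> norm_num
  have hσ1 : |σ| = 1 := by rcases hσ with rfl | rfl <;> simp
  set e := x - σ • u with he
  have hxe : x = σ • u + e := by rw [he]; abel
  have hue := hu.2.2 e trivial
  have huu := hu.2.2 u trivial
  have hbx : P.b x x = 1 + 2 * σ * P.b u e + P.b e e := by
    rw [hxe]
    simp only [map_add, map_smul, add_apply, smul_apply, smul_eq_mul, P.b_symm e u, hub]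
    linear_combination hσ2
  have hax : P.a x x = lam + 2 * σ * (lam * P.b u e) + P.a e e := by
    rw [hxe]
    simp only [map_add, map_smul, add_apply, smul_apply, smul_eq_mul, P.a_symm e u, hue, huu, hub]
    linear_combination lam * hσ2
  have hbe : |P.b u e| ≤ 1 / 4 := by
    have h1 := P.abs_a_le u e
    rw [hue, abs_mul, abs_of_pos hlam] at h1
    refine le_of_mul_le_mul_left ?_ hlam
    linarith
  have hb : 1 / 2 ≤ P.b x x := by
    have h1 : |2 * σ * P.b u e| ≤ 1 / 2 := by
      rw [abs_mul, abs_mul, hσ1, abs_two]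
      linarith
    have h2 := (abs_le.1 h1).1
    have h3 := P.b_nonneg e
    rw [hbx]
    linarith
  have hbpos : 0 < P.b x x := by linarith
  -- The terms linear in `e` cancel by the eigenvalue equation, which gives second order.
  have hdiff : P.a x x / P.b x x - lam = (P.a e e - lam * P.b e e) / P.b x x := by
    rw [div_sub' hbpos.ne', hax]
    congr 1
    rw [hbx]
    ring
  have h1 := P.a_nonneg e
  have h2 := mul_nonneg hlam.le (P.b_nonneg e)
  have h3 := mul_le_mul_of_nonneg_left (hK e e) hlam.le
  rw [hdiff, abs_div, abs_of_pos hbpos, div_le_iff₀ hbpos]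
  have h4 : |P.a e e - lam * P.b e e| ≤ (1 + lam * K) * P.aNorm e ^ 2 := by
    rw [← aNorm_sq] at h1 ⊢
    rw [abs_le]
    constructor <;> nlinarith
  have h5 := (abs_nonneg _).trans h4
  nlinarith

section
variable [CompleteSpace V]

theorem eta_nonneg (P : EigenProblem V) (U : Submodule ℝ V) : 0 ≤ P.eta U :=
  Real.sSup_nonneg (by rintro _ ⟨w, -, rfl⟩; exact P.aDist_nonneg U _)

/-- Lets `η_a(H)` serve as the approximation constant of every enriched space. -/
theorem aNorm_T_sub_proj_le_of_le (P : EigenProblem V) {U W : Submodule ℝ V} [CompleteSpace U]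
    [CompleteSpace W] (h : U ≤ W) (f : V) :
    P.aNorm (P.T f - P.proj W (P.T f)) ≤ P.eta U * P.aNorm f :=
  (P.aNorm_sub_proj_le W _ (h (P.proj_mem U _))).trans (P.aNorm_T_sub_proj_le U f)

theorem epsilon_succ (P : EigenProblem V) (lam : ℝ) (Vh : ℕ → Submodule ℝ V) (k : ℕ) :
    P.epsilon lam Vh (k + 1) = P.delta lam (Vh (k + 1)) + P.eta (Vh 1) * P.epsilon lam Vh k := by
  rw [epsilon, Finset.sum_Icc_succ_top (by omega), epsilon, Finset.mul_sum, add_comm]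
  congr 1
  · simp
  · refine Finset.sum_congr rfl fun j hj => ?_
    rw [Nat.succ_sub (Finset.mem_Icc.1 hj).2, pow_succ]
    ring

theorem epsilon_nonneg (P : EigenProblem V) (lam : ℝ) (Vh : ℕ → Submodule ℝ V) (k : ℕ) :
    0 ≤ P.epsilon lam Vh k :=
  Finset.sum_nonneg fun _ _ => mul_nonneg (pow_nonneg (P.eta_nonneg _) _) (P.delta_nonneg _ _)

/-- The error of a Galerkin solution in terms of the consistency of its source data. -/
theorem IsSourceSolution.aNorm_sub_le {P : EigenProblem V} {U : Submodule ℝ V} [CompleteSpace U]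
    {lam σ : ℝ} {u f x : V} (hx : P.IsSourceSolution U f x) (hu : P.IsEigenpair ⊤ lam u)
    (hσ : σ = 1 ∨ σ = -1) :
    P.aNorm (x - σ • u) ≤ P.aDist U u + P.aNorm (P.T (f - σ • lam • u)) := by
  have hz : P.aNorm (x - σ • P.proj U u) ≤ P.aNorm (P.T (f - σ • lam • u)) := by
    apply P.aNorm_le_of_sq_le (P.aNorm_nonneg _)
    have hzU : x - σ • P.proj U u ∈ U := U.sub_mem hx.1 (U.smul_mem _ (P.proj_mem U u))
    set z := x - σ • P.proj U u with hz
    have h1 : P.a z z = P.a (P.T (f - σ • lam • u)) z := by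
      have e1 : P.a z z = P.a x z - σ * P.a (P.proj U u) z := by
        conv_lhs => rw [hz]
        rw [map_sub P.a, map_smul P.a, sub_apply, smul_apply, smul_eq_mul]
      rw [e1, hx.2 z hzU, P.a_proj U u hzU, hu.2.2 z trivial, a_T]
      simp only [map_sub P.b, map_smul P.b, sub_apply, smul_apply, smul_eq_mul]
    rw [h1]
    exact P.a_le _ _
  have h2 : x - σ • u = (x - σ • P.proj U u) - σ • (u - P.proj U u) := by module
  have h3 : |σ| = 1 := by rcases hσ with rfl | rfl <;> simp
  rw [h2]
  refine (P.aNorm_sub_le _ _).trans ?_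
  rw [aNorm_smul, h3, one_mul, aDist_eq]
  linarith

/-- After `k` steps the eigenpair comes from a finite-dimensional space containing the coarse one,
whose distance to the exact eigenvector is controlled by `ε_{h_k}`. -/
theorem IsMultilevelCorrection.exists_space {P : EigenProblem V} {i n : ℕ} {lam C η₀ : ℝ} {u : V}
    {Vh : ℕ → Submodule ℝ V} {lamh : ℕ → ℝ} {uh : ℕ → V}
    (h : P.IsMultilevelCorrection i n Vh lamh uh) (hu : P.IsEigenpair ⊤ lam u)
    (hub : P.b u u = 1) (hsimple : P.IsSimple lam)
    (hfin : ∀ k, 1 ≤ k → k ≤ n → FiniteDimensional ℝ (Vh k)) (hC : 0 < C)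
    (hη : P.eta (Vh 1) ≤ η₀)
    (hest : ∀ (W : Submodule ℝ V) [CompleteSpace W] (η : ℝ), 0 ≤ η → η ≤ η₀ →
      (∀ f, P.aNorm (P.T f - P.proj W (P.T f)) ≤ η * P.aNorm f) →
      ∀ ν w, P.IsNthEigenpair W i ν w →
        ∃ σ : ℝ, (σ = 1 ∨ σ = -1) ∧
          P.aNorm (P.T (ν • w - σ • lam • u)) ≤ C * η * P.aNorm (u - P.proj W u))
    {k : ℕ} (hk : 1 ≤ k) (hkn : k < n) :
    ∃ W : Submodule ℝ V, FiniteDimensional ℝ W ∧ Vh 1 ≤ W ∧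
      P.IsNthEigenpair W i (lamh k) (uh k) ∧
      P.aDist W u ≤ (1 + C) ^ k * P.epsilon lam Vh k := by
  induction k, hk using Nat.le_induction with
  | base =>
    have hf1 := hfin 1 le_rfl hkn.le
    have := FiniteDimensional.complete ℝ (Vh 1)
    refine ⟨Vh 1, hf1, le_rfl, h.init, ?_⟩
    have h1 := P.epsilon_succ lam Vh 0
    have h2 := mul_nonneg (P.eta_nonneg (Vh 1)) (P.epsilon_nonneg lam Vh 0)
    rw [zero_add, P.delta_eq hu hub hsimple] at h1
    have h3 := mul_nonneg hC.le (P.epsilon_nonneg lam Vh 1)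
    rw [pow_one]
    linarith
  | succ k hk ih =>
    obtain ⟨W, hWf, hVW, hW, hd⟩ := ih (by omega)
    have hf1 := hfin 1 le_rfl (by omega)
    have hfk := hfin (k + 1) (by omega) hkn.le
    have := FiniteDimensional.complete ℝ (Vh 1)
    have := FiniteDimensional.complete ℝ (Vh (k + 1))
    have := FiniteDimensional.complete ℝ W
    obtain ⟨wt, hwt, hpair⟩ := h.step k hk hkn
    have hWn : FiniteDimensional ℝ (Vh 1 ⊔ Submodule.span ℝ {wt} : Submodule ℝ V) :=
      inferInstance
    have := FiniteDimensional.complete ℝ (Vh 1 ⊔ Submodule.span ℝ {wt} : Submodule ℝ V)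
    refine ⟨_, hWn, le_sup_left, hpair, ?_⟩
    obtain ⟨σ, hσ, hT⟩ := hest W (P.eta (Vh 1)) (P.eta_nonneg _) hη
      (P.aNorm_T_sub_proj_le_of_le hVW) _ _ hW
    rw [← aDist_eq] at hT
    -- The new space contains `wt`, so its distance to `u` is at most the error of `wt`; the
    -- discrete eigenvector itself is never compared with `u` here.
    refine (P.aDist_le_of_mem hσ
      (Submodule.mem_sup_right (Submodule.mem_span_singleton_self wt))).trans ?_
    refine (hwt.aNorm_sub_le hu hσ).trans ?_
    rw [epsilon_succ, P.delta_eq hu hub hsimple]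
    have h1 := mul_le_mul_of_nonneg_left hd (mul_nonneg hC.le (P.eta_nonneg (Vh 1)))
    have h2 : (1 : ℝ) ≤ (1 + C) ^ (k + 1) := one_le_pow₀ (by linarith)
    have h3 := le_mul_of_one_le_left (P.aDist_nonneg (Vh (k + 1)) u) h2
    have h4 : 0 ≤ (1 + C) ^ k * (P.eta (Vh 1) * P.epsilon lam Vh k) := by
      have := P.eta_nonneg (Vh 1)
      have := P.epsilon_nonneg lam Vh k
      positivity
    calc _ ≤ _ := add_le_add h3 (hT.trans h1)
      _ ≤ _ := by
        rw [pow_succ] at *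
        linarith

end

end EigenProblem

theorem mainTheorem5 {V : Type*} [NormedAddCommGroup V] [InnerProductSpace ℝ V] [CompleteSpace V]
    (P : EigenProblem V) (i : ℕ) (lam : ℝ) (u : V)
    (hu : P.IsNthEigenpair ⊤ i lam u) (hsimple : P.IsSimple lam) :
    ∃ η₀ > (0 : ℝ), ∀ n : ℕ, 2 ≤ n → ∃ C > (0 : ℝ),
      ∀ (Vh : ℕ → Submodule ℝ V) (lamh : ℕ → ℝ) (uh : ℕ → V),
        (∀ k, 1 ≤ k → k ≤ n → FiniteDimensional ℝ (Vh k)) →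
        (∀ k, 1 ≤ k → k < n → Vh k ≤ Vh (k + 1)) →
        P.eta (Vh 1) ≤ η₀ →
        P.IsMultilevelCorrection i n Vh lamh uh →
        (∃ σ : ℝ, (σ = 1 ∨ σ = -1) ∧ P.aNorm (uh n - σ • u) ≤ C * P.epsilon lam Vh n) ∧
        |lamh n - lam| ≤ C * P.epsilon lam Vh n ^ 2 := by
  obtain ⟨-, hue, hub⟩ := id hu
  have hlam := hue.pos
  obtain ⟨η₁, hη₁, C, hC, hest⟩ := P.exists_discrete_estimate hu hsimple
  obtain ⟨K, hK, hb⟩ := P.exists_b_le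
  have hu2 : P.aNorm u ^ 2 = lam := by rw [P.aNorm_sq, hue.2.2 u trivial, hub, mul_one]
  -- Beyond `η₁`, the other two bounds only keep `b(u_{h_n}, u_{h_n})` away from `0` in the final
  -- Rayleigh quotient.
  refine ⟨min η₁ (min 1 (1 / (4 * lam * (1 + C)))), by positivity, fun n hn => ?_⟩
  refine ⟨(1 + C) ^ n + 2 * (1 + lam * K) * ((1 + C) ^ n) ^ 2, by positivity, ?_⟩
  intro Vh lamh uh hfin hnest hη h
  set η := P.eta (Vh 1) with hηdef
  have hη0 : 0 ≤ η := P.eta_nonneg _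
  have hηa : η ≤ η₁ := hη.trans (min_le_left _ _)
  have hηb : η ≤ 1 := hη.trans ((min_le_right _ _).trans (min_le_left _ _))
  have hηc : η * (4 * lam * (1 + C)) ≤ 1 := by
    have := hη.trans ((min_le_right _ _).trans (min_le_right _ _))
    rwa [le_div_iff₀ (by positivity)] at this
  have hle : ∀ k, 1 ≤ k → k ≤ n → Vh 1 ≤ Vh k := by
    intro k hk
    induction k, hk using Nat.le_induction with
    | base => exact fun _ => le_rfl
    | succ k hk ih => exact fun hkn => (ih (by omega)).trans (hnest k hk (by omega))
  obtain ⟨m, rfl⟩ : ∃ m, n = m + 1 := ⟨n - 1, by omega⟩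
  obtain ⟨W, hWf, hVW, hW, hd⟩ :=
    h.exists_space hue hub hsimple hfin hC hηa hest (k := m) (by omega) (by omega)
  have hf1 := hfin 1 le_rfl (by omega)
  have hfn := hfin (m + 1) (by omega) le_rfl
  have := FiniteDimensional.complete ℝ (Vh 1)
  have := FiniteDimensional.complete ℝ (Vh (m + 1))
  have := FiniteDimensional.complete ℝ W
  obtain ⟨σ, hσ, hT⟩ := hest W η hη0 hηa (P.aNorm_T_sub_proj_le_of_le hVW) _ _ hW
  have he := h.final.aNorm_sub_le hue hσ
  rw [Nat.add_sub_cancel] at he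
  have hdW := P.aNorm_sub_proj_eigenvector_le hue (P.aNorm_T_sub_proj_le_of_le hVW)
  have hdn := P.aNorm_sub_proj_eigenvector_le hue
    (P.aNorm_T_sub_proj_le_of_le (hle (m + 1) (by omega) le_rfl))
  rw [← P.aDist_eq] at hT hdW hdn
  rw [← hηdef] at hdW hdn
  have hu0 := P.aNorm_nonneg u
  have hε := P.epsilon_nonneg lam Vh m
  have hε' := P.epsilon_nonneg lam Vh (m + 1)
  -- The crude bound `λη‖u‖_a` on both distances is used instead of `(1 + C)^n ε`, which keeps the
  -- threshold independent of `n`.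
  have hsmall : 4 * (P.aNorm u * P.aNorm (uh (m + 1) - σ • u)) ≤ lam := by
    have h1 : C * η * P.aDist W u ≤ C * 1 * (lam * η * P.aNorm u) := by
      have := P.aDist_nonneg W u
      gcongr
    have h2 : P.aNorm (uh (m + 1) - σ • u) ≤ (1 + C) * (lam * η * P.aNorm u) := by linarith
    calc 4 * (P.aNorm u * P.aNorm (uh (m + 1) - σ • u))
        ≤ 4 * (P.aNorm u * ((1 + C) * (lam * η * P.aNorm u))) := by gcongr
      _ = η * (4 * lam * (1 + C)) * P.aNorm u ^ 2 := by ring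
      _ ≤ 1 * P.aNorm u ^ 2 := by gcongr
      _ = lam := by rw [hu2, one_mul]
  have herr : P.aNorm (uh (m + 1) - σ • u) ≤ (1 + C) ^ (m + 1) * P.epsilon lam Vh (m + 1) := by
    refine he.trans ?_
    rw [P.epsilon_succ, P.delta_eq hue hub hsimple, ← hηdef]
    have h1 := mul_le_mul_of_nonneg_left hd (mul_nonneg hC.le hη0)
    have h2 : (1 : ℝ) ≤ (1 + C) ^ (m + 1) := one_le_pow₀ (by linarith)
    have h3 := le_mul_of_one_le_left (P.aDist_nonneg (Vh (m + 1)) u) h2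
    have h4 : 0 ≤ (1 + C) ^ m * (η * P.epsilon lam Vh m) := by positivity
    refine (add_le_add h3 (hT.trans h1)).trans ?_
    rw [pow_succ]
    linarith
  refine ⟨⟨σ, hσ, herr.trans ?_⟩, ?_⟩
  · exact mul_le_mul_of_nonneg_right (le_add_of_nonneg_right (by positivity)) hε'
  · rw [h.rayleigh]
    refine (P.abs_rayleigh_sub_le hue hub hσ hb hsmall).trans ?_
    have h1 := pow_le_pow_left₀ (P.aNorm_nonneg _) herr 2
    calc _ ≤ 2 * (1 + lam * K) * ((1 + C) ^ (m + 1) * P.epsilon lam Vh (m + 1)) ^ 2 := by gcongr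
      _ = 2 * (1 + lam * K) * ((1 + C) ^ (m + 1)) ^ 2 * P.epsilon lam Vh (m + 1) ^ 2 := by ring
      _ ≤ _ := mul_le_mul_of_nonneg_right (le_add_of_nonneg_left (by positivity))
        (sq_nonneg _)
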